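/- Let $IR(3,\mathbb F_2)$ be the set of all subsets $E\subseteq\mathbb F_2^3\setminus\{0\}$ such that the matroid of $\mathbb F_2$-linear independence on $E$ is a regular matroid of rank $3$, partially ordered by inclusion. The group $G=SL(3,\mathbb F_2)$ acts on this poset by $g\cdot E=\{gv : v\in E\}$, and hence acts linearly on the homology $H_3(IR(3,\mathbb F_2);\mathbb C)$ of the poset, i.e. the simplicial homology of its nerve (equivalently, of the simplicial complex whose $k$-simplices are the chains $x_0<\dots<x_k$ of the poset). Here a matroid is regular if it is represented by the columns of a totally unimodular real matrix. Theorem. $H_3(IR(3,\mathbb F_2);\mathbb C)$ is the unique $8$-dimensional irreducible complex representation of $SL(3,\mathbb F_2)$: it is irreducible, it has dimension $8$, and every irreducible complex representation of $SL(3,\mathbb F_2)$ of dimension $8$ is isomorphic to it. -/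

import Mathlib

namespace RegularMatroid

/-- A matroid `M` (on a finite ground set) is regular if it is represented by the columns of a
totally unimodular real matrix: the columns of `A` are indexed by the elements of `M`, and a set of
elements is independent in `M` exactly when the corresponding columns are linearly independent. -/
def IsRegular {α : Type*} (M : Matroid α) : Prop :=
  ∃ (n : ℕ) (A : Matrix (Fin n) α ℝ),
    (A.submatrix id (Subtype.val : M.E → α)).IsTotallyUnimodular ∧
      ∀ I : Set α, I ⊆ M.E → (M.Indep I ↔ LinearIndepOn ℝ A.col I)

theorem linearIndepOn_augment {r : ℕ} {I J : Set (Fin r → ZMod 2)}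
    (hI : LinearIndepOn (ZMod 2) id I) (hJ : LinearIndepOn (ZMod 2) id J)
    (h : I.ncard < J.ncard) : ∃ e ∈ J, e ∉ I ∧ LinearIndepOn (ZMod 2) id (insert e I) := by
  classical
  by_contra! hcon
  have hsub : J ⊆ Submodule.span (ZMod 2) I := by
    intro e he
    by_contra hn
    exact hcon e he (fun hm => hn (Submodule.subset_span hm)) (hI.id_insert hn)
  have h1 : Module.finrank (ZMod 2) (Submodule.span (ZMod 2) I) = I.ncard := by
    have := finrank_span_set_eq_card (R := ZMod 2) (s := I) hI
    rw [this, ← Set.ncard_eq_toFinset_card']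
  have h2 : Module.finrank (ZMod 2) (Submodule.span (ZMod 2) J) = J.ncard := by
    have := finrank_span_set_eq_card (R := ZMod 2) (s := J) hJ
    rw [this, ← Set.ncard_eq_toFinset_card']
  have h3 := Submodule.finrank_mono (Submodule.span_le.2 hsub)
  omega

/-- The matroid of linear independence over `𝔽₂` on a set `E` of vectors in `𝔽₂ʳ`. -/
def binaryMatroid {r : ℕ} (E : Set (Fin r → ZMod 2)) : Matroid (Fin r → ZMod 2) :=
  (IndepMatroid.ofFinite E.toFinite (fun I => I ⊆ E ∧ LinearIndepOn (ZMod 2) id I)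
    ⟨Set.empty_subset _, linearIndepOn_empty _ _⟩
    (fun _ _ hJ hIJ => ⟨hIJ.trans hJ.1, hJ.2.mono hIJ⟩)
    (fun _ _ hI hJ h => by
      obtain ⟨e, heJ, heI, he⟩ := linearIndepOn_augment hI.2 hJ.2 h
      exact ⟨e, heJ, heI, Set.insert_subset (hJ.1 heJ) hI.1, he⟩)
    (fun _ hI => hI.1)).matroid

@[simp] theorem binaryMatroid_ground {r : ℕ} (E : Set (Fin r → ZMod 2)) :
    (binaryMatroid E).E = E := rfl

@[simp] theorem binaryMatroid_indep_iff {r : ℕ} (E I : Set (Fin r → ZMod 2)) :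
    (binaryMatroid E).Indep I ↔ I ⊆ E ∧ LinearIndepOn (ZMod 2) id I := Iff.rfl

/-- The poset `IR(r, 𝔽₂)` of all subsets of `𝔽₂ʳ ∖ {0}` which are regular matroids of rank `r`,
ordered by inclusion. -/
abbrev IR (r : ℕ) : Type :=
  {E : Set (Fin r → ZMod 2) //
    (0 : Fin r → ZMod 2) ∉ E ∧ IsRegular (binaryMatroid E) ∧ (binaryMatroid E).eRank = r}

theorem IsRegular.map {α : Type*} {M : Matroid α} (hM : IsRegular M) (e : α ≃ α) :
    IsRegular (M.map e e.injective.injOn) := by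
  obtain ⟨n, A, hA, hind⟩ := hM
  refine ⟨n, A.submatrix id e.symm, ?_, ?_⟩
  · have hmem : ∀ x : (M.map e e.injective.injOn).E, e.symm x.1 ∈ M.E := by
      rintro ⟨_, y, hy, rfl⟩
      simpa using hy
    exact hA.submatrix (id : Fin n → Fin n)
      (fun x : (M.map e e.injective.injOn).E => (⟨e.symm x.1, hmem x⟩ : M.E))
  · rintro I hI
    obtain ⟨I, rfl⟩ : ∃ I₀, I = e '' I₀ := ⟨e.symm '' I, by simp [Set.image_image]⟩
    have hI' : I ⊆ M.E := (Set.image_subset_image_iff e.injective).1 hI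
    rw [Matroid.map_image_indep_iff hI', hind I hI', LinearIndepOn, LinearIndepOn,
      ← linearIndependent_equiv (e.image I)]
    have hcol : (fun x : ↥(e '' I) => (A.submatrix id e.symm).col x) ∘ ⇑(e.image I) =
        fun x : I => A.col x := by
      funext x
      funext i
      simp [Matrix.col]
    rw [hcol]

theorem binaryMatroid_image {r : ℕ} (E : Set (Fin r → ZMod 2))
    (f : (Fin r → ZMod 2) ≃ₗ[ZMod 2] (Fin r → ZMod 2)) :
    binaryMatroid (f '' E) = (binaryMatroid E).map f.toEquiv f.toEquiv.injective.injOn := by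
  refine Matroid.ext_indep rfl fun I hI => ?_
  obtain ⟨I, rfl⟩ : ∃ I₀, I = f '' I₀ := ⟨f.symm '' I, by simp [Set.image_image]⟩
  have hI' : I ⊆ E := (Set.image_subset_image_iff f.injective).1 hI
  have h1 : ((binaryMatroid E).map f.toEquiv f.toEquiv.injective.injOn).Indep (f '' I) ↔
      (binaryMatroid E).Indep I := Matroid.map_image_indep_iff (M := binaryMatroid E) hI'
  rw [h1, binaryMatroid_indep_iff, binaryMatroid_indep_iff]
  refine and_congr ⟨fun _ => hI', fun _ => hI⟩ ?_
  rw [LinearIndepOn, LinearIndepOn, ← linearIndependent_equiv (f.toEquiv.image I)]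
  exact f.toLinearMap.linearIndependent_iff (v := fun x : I => (x : Fin r → ZMod 2))
    (LinearMap.ker_eq_bot.2 f.injective)

/-- `SL(r, 𝔽₂)` acts on `IR(r, 𝔽₂)` by `g • E = {g v | v ∈ E}`. -/
noncomputable instance (r : ℕ) :
    MulAction (Matrix.SpecialLinearGroup (Fin r) (ZMod 2)) (IR r) where
  smul g E := ⟨Matrix.SpecialLinearGroup.toLin' g '' E.1, by
    obtain ⟨E, h0, hreg, hrk⟩ := E
    refine ⟨?_, ?_, ?_⟩
    · rintro ⟨x, hx, h⟩
      exact h0 (by rwa [(LinearEquiv.map_eq_zero_iff _).1 h] at hx)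
    · rw [binaryMatroid_image]
      exact hreg.map _
    · rw [binaryMatroid_image, Matroid.eRank_map]
      exact hrk⟩
  one_smul E := Subtype.ext <| by
    change Matrix.SpecialLinearGroup.toLin' 1 '' E.1 = E.1
    simp
  mul_smul g h E := Subtype.ext <| by
    change Matrix.SpecialLinearGroup.toLin' (g * h) '' E.1 =
      Matrix.SpecialLinearGroup.toLin' g '' (Matrix.SpecialLinearGroup.toLin' h '' E.1)
    rw [map_mul, Set.image_image]
    rfl

theorem coe_smul {r : ℕ} (g : Matrix.SpecialLinearGroup (Fin r) (ZMod 2)) (E : IR r) :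
    ((g • E : IR r) : Set (Fin r → ZMod 2)) = (fun v => (g : Matrix _ _ _).mulVec v) '' E.1 := rfl

theorem smul_mono {r : ℕ} (g : Matrix.SpecialLinearGroup (Fin r) (ZMod 2)) :
    Monotone (fun E : IR r => g • E) :=
  fun _ _ h => Set.image_mono h

open CategoryTheory in
/-- The homology `Hₙ(IR(r, 𝔽₂); ℂ)`: the simplicial homology of the nerve of the poset, whose
nondegenerate `k`-simplices are the chains `x₀ < ⋯ < xₖ`. -/
noncomputable abbrev homologyIR (r n : ℕ) : ModuleCat.{0} ℂ :=
  (nerve (IR r)).homology (ModuleCat.of ℂ ℂ) n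

open CategoryTheory in
/-- The representation of `SL(r, 𝔽₂)` on `Hₙ(IR(r, 𝔽₂); ℂ)`: the element `g` acts by the map
induced by the automorphism `E ↦ g • E` of the poset. -/
noncomputable def homologyRep (r n : ℕ) :
    Representation ℂ (Matrix.SpecialLinearGroup (Fin r) (ZMod 2)) (homologyIR r n) where
  toFun g := (SSet.homologyMap (nerveMap (smul_mono (r := r) g).functor)
    (ModuleCat.of ℂ ℂ) n).hom
  map_one' := by
    have h : nerveMap (smul_mono (r := r) 1).functor = 𝟙 (nerve (IR r)) := by
      have hF : (smul_mono (r := r) 1).functor = 𝟭 (IR r) :=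
        CategoryTheory.Functor.ext (fun E => one_smul _ E) (fun _ _ _ => Subsingleton.elim _ _)
      rw [hF]; rfl
    rw [h, SSet.homologyMap_id]
    rfl
  map_mul' g g' := by
    have h : nerveMap (smul_mono (r := r) (g * g')).functor =
        nerveMap (smul_mono (r := r) g').functor ≫ nerveMap (smul_mono (r := r) g).functor := by
      have hF : (smul_mono (r := r) (g * g')).functor =
          (smul_mono (r := r) g').functor ⋙ (smul_mono (r := r) g).functor :=
        CategoryTheory.Functor.ext (fun E => mul_smul _ _ E) (fun _ _ _ => Subsingleton.elim _ _)
      rw [hF]; rfl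
    rw [h, SSet.homologyMap_comp]
    rfl

end RegularMatroid

/-!
The poset `IR(3, 𝔽₂)` is the opposite of the face poset of the independence complex of the dual
Fano matroid: a set `E` corresponds to its complement among the seven points. The complex has
dimension `3`, so `H₃` is its space of top-dimensional cycles: the alternating functions on
`4`-tuples of points which vanish off the faces and sum to `0` over each entry. Such a function is
determined by eight of its values, hence `dim H₃ ≤ 8`.

Let `H` be the normalizer of a Singer cycle in `G = SL(3, 𝔽₂)`, of order `21` and index `8`, and let
`χ` be a nontrivial character of `H` trivial on the Singer cycle. Since `G = H ∪ H t H` for an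
involution `t` that inverts an element of order `3` of `H`, Mackey's criterion holds for `χ`: in any
representation of `G` the eight translates of a nonzero `χ`-eigenvector are linearly independent.
Therefore an `8`-dimensional representation with such an eigenvector is irreducible, and any two
irreducible representations with such an eigenvector are isomorphic.

Pfaffians of circulant forms on `ℤ/7` provide a `χ`-eigenvector in `H₃`, for either choice of `χ`.
Conversely, let `V` be irreducible of dimension `8`. If the Singer cycle had no fixed vector in `V`,
then the character of `V` would vanish at the elements of order `3` of `H`, and `3` would divide
`8`. So `H` has an eigenvector in `V` on which the Singer cycle acts trivially; its eigencharacter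
is nontrivial, because an irreducible representation with a nonzero `H`-fixed vector has dimension
less than `8` or at most `1`.
-/

namespace PosetHomology

open CategoryTheory Simplicial HomologicalComplex Limits

universe u

section NormalizedChains

variable (k : Type u) [CommRing k] (X : Type u) [PartialOrder X] {Y : Type u} [PartialOrder Y]
  {n : ℕ}

/-- The complex of normalized chains of the nerve of a poset `X`, with coefficients in `k`: in
degree `n` it is free on the strict chains `x₀ < ⋯ < xₙ`. -/
noncomputable abbrev normalizedChains : ChainComplex (ModuleCat.{u} k) ℕ :=
  (nerve X).normalizedChainComplex (ModuleCat.of k k)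

variable {X}

/-- The nondegenerate simplices of the nerve of a poset are its strict chains. -/
noncomputable def strictChainEquiv : (Fin (n + 1) ↪o X) ≃ (nerve X).nonDegenerate n where
  toFun x := ⟨x.monotone.functor,
    (PartialOrder.mem_nerve_nonDegenerate_iff_strictMono _).2 x.strictMono⟩
  invFun s := OrderEmbedding.ofStrictMono _
    ((PartialOrder.mem_nerve_nonDegenerate_iff_strictMono s.1).1 s.2)
  left_inv _ := rfl
  right_inv _ := rfl

/-- The normalized chain given by a single strict chain. -/
noncomputable def single (x : Fin (n + 1) ↪o X) : (normalizedChains k X).X n :=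
  ((nerve X).ιNormalizedChainComplex (R := ModuleCat.of k k)
    (strictChainEquiv x : (nerve X) _⦋n⦌)).hom (1 : k)

variable {k}

lemma linearMap_ext {M : Type u} [AddCommGroup M] [Module k M]
    {f g : (normalizedChains k X).X n →ₗ[k] M} (h : ∀ x, f (single k x) = g (single k x)) :
    f = g := by
  suffices ModuleCat.ofHom f = ModuleCat.ofHom g from congr($(this).hom)
  refine SSet.normalizedChainComplex_hom_ext _ fun s hs => ?_
  obtain ⟨x, hx⟩ := strictChainEquiv.surjective ⟨s, hs⟩
  obtain rfl : (strictChainEquiv x : (nerve X) _⦋n⦌) = s := congr($(hx).1)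
  ext
  exact h x

lemma exists_coeff (x : Fin (n + 1) ↪o X) :
    ∃ f : (normalizedChains k X).X n →ₗ[k] k,
      f (single k x) = 1 ∧ ∀ y ≠ x, f (single k y) = 0 := by
  classical
  let f := Cofan.IsColimit.desc
    ((nerve X).isColimitCofanNormalizedChainComplex (ModuleCat.of k k) n)
    fun s => if s = strictChainEquiv x then 𝟙 _ else 0
  have hf (y : Fin (n + 1) ↪o X) : f.hom (single k y) = if y = x then 1 else 0 := by
    have := Cofan.IsColimit.fac
      ((nerve X).isColimitCofanNormalizedChainComplex (ModuleCat.of k k) n)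
      (fun s => if s = strictChainEquiv x then 𝟙 _ else 0) (strictChainEquiv y)
    refine congr($(this).hom (1 : k)).trans ?_
    split_ifs <;> simp_all
  exact ⟨f.hom, by simp [hf], fun y hy => by simp [hf, hy]⟩

lemma linearIndependent_single :
    LinearIndependent k (single k : (Fin (n + 1) ↪o X) → _) := by
  refine linearIndependent_iff.2 fun l hl => Finsupp.ext fun x => ?_
  obtain ⟨f, hfx, hf⟩ := exists_coeff (k := k) x
  have h := congr(f $hl)
  rw [Finsupp.linearCombination_apply, map_finsuppSum, Finsupp.sum,
    Finset.sum_eq_single x (fun y _ hy => by simp [hf y hy]) (by simp +contextual)] at h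
  simpa [hfx] using h

lemma span_range_single :
    Submodule.span k (Set.range (single k : (Fin (n + 1) ↪o X) → _)) = ⊤ := by
  rw [← Submodule.ker_mkQ (Submodule.span k _), LinearMap.ker_eq_top]
  exact linearMap_ext fun x => by
    simpa using Submodule.subset_span (Set.mem_range_self x)

variable (k X n) in
/-- The basis of the module of normalized `n`-chains which consists of the strict chains. -/
noncomputable def chainBasis : Module.Basis (Fin (n + 1) ↪o X) k ((normalizedChains k X).X n) :=
  Module.Basis.mk linearIndependent_single span_range_single.ge

/-- The face of a strict chain obtained by omitting one element. -/
def face (i : Fin (n + 2)) (x : Fin (n + 2) ↪o X) : Fin (n + 1) ↪o X :=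
  (Fin.succAboveOrderEmb i).trans x

lemma d_chainBasis (x : Fin (n + 2) ↪o X) :
    ((normalizedChains k X).d (n + 1) n).hom (chainBasis k X (n + 1) x) =
      ∑ i : Fin (n + 2), (-1 : k) ^ (i : ℕ) • chainBasis k X n (face i x) := by
  simp only [chainBasis, Module.Basis.mk_apply]
  have h := (nerve X).ιNormalizedChainComplex_d (R := ModuleCat.of k k)
    (strictChainEquiv x : (nerve X) _⦋n + 1⦌)
  refine congr($(h).hom (1 : k)).trans ?_
  rw [ModuleCat.hom_sum, LinearMap.sum_apply]
  refine Finset.sum_congr rfl fun i _ => ?_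
  rw [show (-1 : k) ^ (i : ℕ) = ((-1 : ℤ) ^ (i : ℕ) : ℤ) by simp, Int.cast_smul_eq_zsmul]
  rfl

lemma map_chainBasis (φ : X ↪o Y) (x : Fin (n + 1) ↪o X) :
    ((SSet.normalizedChainComplexMap (nerveMap φ.monotone.functor) (ModuleCat.of k k)).f n).hom
      (chainBasis k X n x) = chainBasis k Y n (x.trans φ) := by
  simp only [chainBasis, Module.Basis.mk_apply]
  exact congr($(SSet.ι_normalizedChainComplexMap_f (nerveMap φ.monotone.functor)
    (R := ModuleCat.of k k) (strictChainEquiv x : (nerve X) _⦋n⦌)).hom (1 : k))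

lemma coord_map_chain (φ : X ↪o Y) (w : (normalizedChains k X).X n) (x : Fin (n + 1) ↪o X) :
    (chainBasis k Y n).coord (x.trans φ)
        (((SSet.normalizedChainComplexMap (nerveMap φ.monotone.functor)
          (ModuleCat.of k k)).f n).hom w) = (chainBasis k X n).coord x w := by
  classical
  suffices (chainBasis k Y n).coord (x.trans φ) ∘ₗ ((SSet.normalizedChainComplexMap
      (nerveMap φ.monotone.functor) (ModuleCat.of k k)).f n).hom = (chainBasis k X n).coord x from
    congr($this w)
  refine (chainBasis k X n).ext fun y => ?_
  have hinj : y.trans φ = x.trans φ ↔ y = x :=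
    ⟨fun h => RelEmbedding.ext fun i => φ.injective congr($h i), congrArg (RelEmbedding.trans · φ)⟩
  simp only [LinearMap.comp_apply, map_chainBasis, Module.Basis.coord_apply,
    Module.Basis.repr_self, Finsupp.single_apply, hinj]

end NormalizedChains

section TopDegree

variable (k : Type u) [CommRing k] {X Y : Type u} [PartialOrder X] [PartialOrder Y] {n : ℕ}

lemma subsingleton_normalizedChains {r : X → Fin n} (hr : StrictMono r) :
    Subsingleton ((normalizedChains k X).X n) := by
  have : IsEmpty (Fin (n + 1) ↪o X) := ⟨fun x => by
    simpa using Fintype.card_le_of_injective _ (hr.comp x.strictMono).injective⟩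
  exact (chainBasis k X n).repr.injective.subsingleton

variable (X n) in
/-- The simplicial homology of the nerve of a poset, with coefficients in `k`. -/
noncomputable abbrev nerveHomology : ModuleCat.{u} k :=
  (nerve X).homology (ModuleCat.of k k) n

/-- If a poset has no chains with `n + 2` elements, a homology class of degree `n` has a unique
normalized representative. -/
noncomputable def homologyIsoCycles {r : X → Fin (n + 1)} (hr : StrictMono r) :
    nerveHomology k X n ≅ (normalizedChains k X).cycles n :=
  haveI := subsingleton_normalizedChains k hr
  haveI := HomologicalComplex.isIso_homologyπ (normalizedChains k X) (n + 1) n (by simp)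
    ((ModuleCat.isZero_of_subsingleton _).eq_of_src _ _)
  (asIso (HomologicalComplex.homologyMap ((nerve X).toNormalizedChainComplex _) n)).trans
    (asIso ((normalizedChains k X).homologyπ n)).symm

lemma homologyIsoCycles_naturality {r : X → Fin (n + 1)} (hr : StrictMono r)
    {s : Y → Fin (n + 1)} (hs : StrictMono s) (φ : X ↪o Y) :
    SSet.homologyMap (nerveMap φ.monotone.functor) (ModuleCat.of k k) n ≫
        (homologyIsoCycles k hs).hom =
      (homologyIsoCycles k hr).hom ≫ HomologicalComplex.cyclesMap
        (SSet.normalizedChainComplexMap (nerveMap φ.monotone.functor) (ModuleCat.of k k)) n := by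
  rw [homologyIsoCycles, homologyIsoCycles, Iso.trans_hom, Iso.trans_hom, Iso.symm_hom,
    Iso.symm_hom, asIso_inv, asIso_inv]
  simp only [asIso_hom, ← Category.assoc, IsIso.comp_inv_eq]
  simp only [Category.assoc, ← HomologicalComplex.homologyπ_naturality, IsIso.inv_hom_id_assoc,
    ← HomologicalComplex.homologyMap_comp, SSet.toNormalizedChainComplex_normalizedChainComplexMap]

lemma exists_iCycles_eq (w : (normalizedChains k X).X (n + 1))
    (hw : ((normalizedChains k X).d (n + 1) n).hom w = 0) :
    ∃ c, ((normalizedChains k X).iCycles (n + 1)).hom c = w := by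
  let l : ModuleCat.of k k ⟶ (normalizedChains k X).X (n + 1) :=
    ModuleCat.ofHom (LinearMap.toSpanSingleton k _ w)
  have hl : l ≫ (normalizedChains k X).d (n + 1) n = 0 := by
    ext
    exact (congrArg _ (one_smul k w)).trans hw
  refine ⟨((normalizedChains k X).liftCycles l n (by simp) hl).hom (1 : k), ?_⟩
  exact congr($((normalizedChains k X).liftCycles_i l n (by simp) hl).hom (1 : k)).trans
    (one_smul k w)

variable [Finite X] [Finite Y]

instance : Finite (Fin n ↪o X) :=
  DFunLike.finite _

noncomputable instance : Fintype (Fin n ↪o X) :=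
  Fintype.ofFinite _

/-- The coefficients at the strict chains of maximal length of a homology class of top degree. -/
noncomputable def topCoeff {r : X → Fin (n + 1)} (hr : StrictMono r) :
    nerveHomology k X n →ₗ[k] (Fin (n + 1) ↪o X) → k :=
  (chainBasis k X n).equivFun.toLinearMap ∘ₗ
    ((normalizedChains k X).iCycles n).hom ∘ₗ (homologyIsoCycles k hr).hom.hom

lemma topCoeff_injective {r : X → Fin (n + 1)} (hr : StrictMono r) :
    Function.Injective (topCoeff k hr) :=
  (chainBasis k X n).equivFun.injective.comp <|
    ((ModuleCat.mono_iff_injective ((normalizedChains k X).iCycles n)).1 inferInstance).comp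
      (homologyIsoCycles k hr).toLinearEquiv.injective

lemma topCoeff_homologyMap {r : X → Fin (n + 1)} (hr : StrictMono r) {s : Y → Fin (n + 1)}
    (hs : StrictMono s) (φ : X ↪o Y)
    (z : nerveHomology k X n) (x : Fin (n + 1) ↪o X) :
    topCoeff k hs ((SSet.homologyMap (nerveMap φ.monotone.functor) (ModuleCat.of k k) n).hom z)
      (x.trans φ) = topCoeff k hr z x := by
  have h := congr($(homologyIsoCycles_naturality k hr hs φ) ≫ (normalizedChains k Y).iCycles n)
  rw [Category.assoc, Category.assoc, HomologicalComplex.cyclesMap_i] at h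
  rw [topCoeff, topCoeff]
  refine (congr((chainBasis k Y n).coord (x.trans φ) (($h).hom z))).trans ?_
  exact coord_map_chain φ _ x

open Classical in
variable (X n) in
/-- The cycles of top degree `n + 1` of a graded poset: the functions on the maximal chains
whose sum over the chains with a given face of a given rank vanishes. -/
def topCycles : Submodule k ((Fin (n + 2) ↪o X) → k) where
  carrier := {f | ∀ i x, ∑ y with face i y = face i x, f y = 0}
  add_mem' hf hg i x := by simp [Finset.sum_add_distrib, hf i x, hg i x]
  zero_mem' i x := by simp
  smul_mem' c f hf i x := by simp [← Finset.mul_sum, hf i x]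

omit [Finite X] in
/-- Since `r (x j) = j` on a maximal chain `x`, the position of the omitted element can be read
off a face, so the terms of the differential with different `i` do not interact. -/
lemma eq_of_face_eq {r : X → Fin (n + 2)} (hr : StrictMono r) {i j : Fin (n + 2)}
    {x y : Fin (n + 2) ↪o X} (h : face i x = face j y) : i = j := by
  have hid (x : Fin (n + 2) ↪o X) (l : Fin (n + 2)) : r (x l) = l :=
    congr_fun (hr.comp x.strictMono).eq_id l
  refine Fin.succAbove_left_injective (funext fun l => ?_)
  rw [← hid x (i.succAbove l), ← hid y (j.succAbove l)]
  exact congr(r ($h l))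

open Classical in
lemma d_apply (w : (normalizedChains k X).X (n + 1)) :
    ((normalizedChains k X).d (n + 1) n).hom w = ∑ i : Fin (n + 2), ∑ x,
      ((-1 : k) ^ (i : ℕ) * (chainBasis k X (n + 1)).equivFun w x) •
        chainBasis k X n (face i x) := by
  conv_lhs => rw [← (chainBasis k X (n + 1)).sum_equivFun w]
  simp only [map_sum, map_smul, d_chainBasis, Finset.smul_sum, smul_smul]
  rw [Finset.sum_comm]
  simp only [mul_comm]

lemma d_eq_zero_iff {r : X → Fin (n + 2)} (hr : StrictMono r)
    (w : (normalizedChains k X).X (n + 1)) :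
    ((normalizedChains k X).d (n + 1) n).hom w = 0 ↔
      (chainBasis k X (n + 1)).equivFun w ∈ topCycles k X n := by
  classical
  have hcoeff (i : Fin (n + 2)) (x : Fin (n + 2) ↪o X) :
      (chainBasis k X n).repr (((normalizedChains k X).d (n + 1) n).hom w) (face i x) =
        (-1 : k) ^ (i : ℕ) *
          ∑ y with face i y = face i x, (chainBasis k X (n + 1)).equivFun w y := by
    simp only [d_apply, map_sum, map_smul, Module.Basis.repr_self, Finsupp.coe_finsetSum,
      Finset.sum_apply, Finsupp.smul_apply, Finsupp.single_apply, Finset.mul_sum,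
      Finset.sum_filter]
    rw [Finset.sum_eq_single i]
    · refine Finset.sum_congr rfl fun y _ => ?_
      split_ifs <;> simp
    · exact fun j _ hj => Finset.sum_eq_zero fun y _ => by
        rw [if_neg fun h => hj (eq_of_face_eq hr h), smul_zero]
    · simp
  constructor
  · intro h i x
    have := hcoeff i x
    rw [h, map_zero, Finsupp.zero_apply] at this
    exact ((isUnit_one.neg.pow (i : ℕ)).mul_right_eq_zero).1 this.symm
  · intro h
    rw [← (chainBasis k X n).repr.map_eq_zero_iff]
    ext t
    by_cases ht : ∃ i x, face i x = t
    · obtain ⟨i, x, rfl⟩ := ht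
      rw [hcoeff, h i x, mul_zero, Finsupp.zero_apply]
    · push Not at ht
      simp [d_apply, ht]

lemma range_topCoeff {r : X → Fin (n + 2)} (hr : StrictMono r) :
    LinearMap.range (topCoeff k hr) = topCycles k X n := by
  refine le_antisymm ?_ fun f hf => ?_
  · rintro _ ⟨z, rfl⟩
    refine (d_eq_zero_iff k hr _).1 ?_
    exact congr($((normalizedChains k X).iCycles_d (n + 1) n).hom
      ((homologyIsoCycles k hr).hom.hom z))
  · obtain ⟨w, rfl⟩ := (chainBasis k X (n + 1)).equivFun.surjective f
    obtain ⟨c, rfl⟩ := exists_iCycles_eq k w ((d_eq_zero_iff k hr w).2 hf)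
    refine ⟨(homologyIsoCycles k hr).inv.hom c, ?_⟩
    rw [topCoeff, LinearMap.comp_apply, LinearMap.comp_apply]
    exact congr((chainBasis k X (n + 1)).equivFun (((normalizedChains k X).iCycles (n + 1)).hom
      ($((homologyIsoCycles k hr).inv_hom_id).hom c)))

end TopDegree

end PosetHomology

namespace FacePoset

open CategoryTheory Finset PosetHomology
open Equiv (Perm swap)

section Flags

variable {P : Type*} [DecidableEq P] {n : ℕ}

/-- The flag of sets attached to a tuple: its `l`-th member consists of the entries of `d` from
position `l` on. -/
def flag (d : Fin n → P) (l : ℕ) : Finset P :=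
  ({i | l ≤ i} : Finset (Fin n)).image d

lemma mem_flag {d : Fin n → P} {l : ℕ} {p : P} : p ∈ flag d l ↔ ∃ i : Fin n, l ≤ i ∧ d i = p := by
  simp [flag]

lemma flag_zero (d : Fin n → P) : flag d 0 = univ.image d := by
  simp [flag]

lemma flag_antitone (d : Fin n → P) : Antitone (flag d) := fun _ _ h _ hp => by
  obtain ⟨i, hi, rfl⟩ := mem_flag.1 hp
  exact mem_flag.2 ⟨i, h.trans hi, rfl⟩

lemma card_flag {d : Fin n → P} (hd : Function.Injective d) (l : ℕ) : #(flag d l) = n - l := by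
  rw [flag, card_image_of_injective _ hd]
  rcases le_or_gt n l with h | h
  · rw [Nat.sub_eq_zero_of_le h, card_eq_zero, filter_eq_empty_iff]
    exact fun i _ => by omega
  · rw [show ({i : Fin n | l ≤ i} : Finset (Fin n)) = Ici ⟨l, h⟩ by ext; simp [Fin.le_def],
      Fin.card_Ici]

lemma flag_of_le (d : Fin n → P) {l : ℕ} (h : n ≤ l) : flag d l = ∅ := by
  simp only [flag, image_eq_empty, filter_eq_empty_iff]
  exact fun i _ => by omega

lemma flag_cons (p : P) (d : Fin n → P) :
    flag (Fin.cons p d : Fin (n + 1) → P) 0 = insert p (flag d 0) ∧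
      ∀ l, flag (Fin.cons p d : Fin (n + 1) → P) (l + 1) = flag d l := by
  refine ⟨?_, fun l => ?_⟩ <;> ext q <;>
    simp [mem_flag, Fin.exists_fin_succ, eq_comm]

lemma exists_flag_eq {S : ℕ → Finset P} (hS : Antitone S) (hcard : ∀ l, #(S l) = n - l) :
    ∃ d : Fin n → P, flag d = S := by
  induction n generalizing S with
  | zero => exact ⟨Fin.elim0, funext fun l => by
      rw [flag_of_le _ l.zero_le, eq_comm, ← card_eq_zero, hcard, Nat.zero_sub]⟩
  | succ n ih =>
    obtain ⟨d, hd⟩ := ih (S := fun l => S (l + 1)) (fun a b h => hS (by omega))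
      fun l => by rw [hcard]; omega
    obtain ⟨p, -, hp⟩ : ∃ p ∉ S 1, insert p (S 1) = S 0 :=
      exists_eq_insert_iff.2 ⟨hS zero_le_one, by rw [hcard, hcard]; omega⟩
    obtain ⟨h0, hsucc⟩ := flag_cons p d
    refine ⟨Fin.cons p d, funext fun l => ?_⟩
    cases l with
    | zero => rw [h0, hd, hp]
    | succ l => rw [hsucc, hd]

lemma exists_eq_of_flag_eq {d d' : Fin n → P} (hd : Function.Injective d) {a b : ℕ}
    (ha : flag d a = flag d' a) (hb : flag d b = flag d' b) {m : Fin n} (ham : a ≤ m)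
    (hmb : m < b) : ∃ m' : Fin n, a ≤ m' ∧ m' < b ∧ d m = d' m' := by
  obtain ⟨m', ham', hm'⟩ := mem_flag.1 (ha ▸ mem_flag.2 ⟨m, ham, rfl⟩)
  refine ⟨m', ham', ?_, hm'.symm⟩
  by_contra! hbm'
  obtain ⟨i, hi, him⟩ := mem_flag.1 (hb ▸ mem_flag.2 ⟨m', hbm', hm'⟩)
  obtain rfl := hd him
  omega

lemma apply_eq_of_flag_eq {d d' : Fin n → P} (hd : Function.Injective d) {m : Fin n}
    (h : flag d m = flag d' m) (h' : flag d (m + 1) = flag d' (m + 1)) : d m = d' m := by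
  obtain ⟨m', h1, h2, h3⟩ := exists_eq_of_flag_eq hd h h' le_rfl (Nat.lt_succ_self _)
  rwa [show m' = m by omega] at h3

lemma flag_injOn : Set.InjOn (flag : (Fin n → P) → ℕ → Finset P) {d | Function.Injective d} :=
  fun _ hd _ _ h => funext fun _ => apply_eq_of_flag_eq hd (congr_fun h _) (congr_fun h _)

lemma flag_update_zero (d : Fin (n + 1) → P) (p : P) {l : ℕ} (hl : l ≠ 0) :
    flag (Function.update d 0 p) l = flag d l := by
  ext q
  rw [mem_flag, mem_flag]
  refine exists_congr fun i => and_congr_right fun hi => ?_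
  rw [Function.update_of_ne]
  rintro rfl
  exact hl (Nat.le_zero.1 hi)

lemma eq_update_of_flag_eq {d d' : Fin (n + 1) → P} (hd' : Function.Injective d')
    (h : ∀ l ≠ 0, flag d' l = flag d l) : d' = Function.update d 0 (d' 0) := by
  funext i
  refine Fin.cases (by simp) (fun i => ?_) i
  rw [Function.update_of_ne (Fin.succ_ne_zero i)]
  exact apply_eq_of_flag_eq hd' (h _ (by simp)) (h _ (by simp))

lemma flag_comp_perm (d : Fin n → P) (σ : Perm (Fin n)) {l : ℕ}
    (h : ∀ i : Fin n, l ≤ i → l ≤ σ i) : flag (d ∘ σ) l = flag d l := by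
  rw [flag, ← image_image, flag, eq_of_subset_of_card_le (s := image σ _) (t := {i | l ≤ i})]
  · simpa [image_subset_iff] using h
  · rw [card_image_of_injective _ σ.injective]

lemma eq_or_eq_comp_swap_of_flag_eq {d d' : Fin (n + 2) → P} (hd' : Function.Injective d')
    {j : Fin (n + 1)}
    (h : ∀ l ≠ (j : ℕ) + 1, flag d' l = flag d l) :
    d' = d ∨ d' = d ∘ swap j.castSucc j.succ := by
  have hout (i : Fin (n + 2)) (h1 : i ≠ j.castSucc) (h2 : i ≠ j.succ) : d' i = d i :=
    apply_eq_of_flag_eq hd' (h _ fun h => h2 (Fin.ext h))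
      (h _ fun h => h1 (Fin.ext (Nat.succ_injective h)))
  have hin (i : Fin (n + 2)) (h1 : (j : ℕ) ≤ i) (h2 : (i : ℕ) < j + 2) :
      d' i = d j.castSucc ∨ d' i = d j.succ := by
    obtain ⟨m, hm1, hm2, hm⟩ := exists_eq_of_flag_eq hd' (h j (by simp)) (h (j + 2) (by simp)) h1 h2
    rcases (show (m : ℕ) = j ∨ (m : ℕ) = j + 1 by omega) with h | h
    · exact .inl (hm.trans (congrArg d (Fin.ext h)))
    · exact .inr (hm.trans (congrArg d (Fin.ext h)))
  have hne : d' j.castSucc ≠ d' j.succ := hd'.ne (Fin.castSucc_lt_succ).ne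
  rcases hin j.castSucc (by simp) (by simp) with h1 | h1 <;>
    rcases hin j.succ (by simp) (by simp) with h2 | h2
  · exact absurd (h1.trans h2.symm) hne
  · refine .inl (funext fun i => ?_)
    grind
  · refine .inr (funext fun i => ?_)
    grind
  · exact absurd (h1.trans h2.symm) hne

end Flags

section Chains

universe u

variable {P : Type u} [DecidableEq P] {n : ℕ} (K : PreAbstractSimplicialComplex P)

/-- The tuple `d` is an ordering of the vertices of a face of `K`. -/
def IsOrderedFace (d : Fin n → P) : Prop :=
  Function.Injective d ∧ univ.image d ∈ K

variable {K}

lemma IsOrderedFace.comp_perm {d : Fin n → P} (hd : IsOrderedFace K d) (σ : Perm (Fin n)) :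
    IsOrderedFace K (d ∘ σ) :=
  ⟨hd.1.comp σ.injective, by
    rw [← image_image, image_univ_of_surjective σ.surjective]; exact hd.2⟩

lemma flag_mem {d : Fin n → P} (hd : IsOrderedFace K d) (l : Fin n) : flag d l ∈ K :=
  K.isRelLowerSet_faces.mem_of_le hd.2 (flag_zero d ▸ flag_antitone d l.val.zero_le)
    ⟨d l, mem_flag.2 ⟨l, le_rfl, rfl⟩⟩

lemma flag_strictAnti {d : Fin n → P} (hd : Function.Injective d) :
    StrictAnti fun l : Fin n => flag d l := fun l m h =>
  (flag_antitone d h.le).lt_of_ne fun hlm => by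
    have := congrArg card hlm
    rw [card_flag hd, card_flag hd] at this
    omega

variable {X : Type u} [PartialOrder X] (e : X ≃o (↥K)ᵒᵈ)

/-- The vertices of the face of `K` which corresponds to `x : X`. -/
def vertices (x : X) : Finset P :=
  (OrderDual.ofDual (e x)).1

omit [DecidableEq P] in
lemma vertices_injective : Function.Injective (vertices e) :=
  fun _ _ h => e.injective (congrArg OrderDual.toDual (Subtype.ext h))

omit [DecidableEq P] in
lemma vertices_strictAnti : StrictAnti (vertices e) :=
  fun _ _ h => e.lt_iff_lt.2 h

variable (hK : ∀ S ∈ K, #S ≤ n + 1)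

/-- The rank function of the opposite of the face poset: the codimension of a face. -/
def codim (x : X) : Fin (n + 1) :=
  ⟨n + 1 - #(vertices e x), by
    have : 0 < #(vertices e x) :=
      (K.isRelLowerSet_faces.prop_of_mem (OrderDual.ofDual (e x)).2).card_pos
    omega⟩

include hK

omit [DecidableEq P] in
lemma codim_strictMono : StrictMono (codim e (n := n)) := fun x y h => by
  have hlt := card_lt_card (vertices_strictAnti e h)
  have hle : #(vertices e x) ≤ n + 1 := hK _ (OrderDual.ofDual (e x)).2
  simp only [codim, Fin.mk_lt_mk]
  omega

omit [DecidableEq P] in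
lemma card_vertices (x : Fin (n + 1) ↪o X) (l : Fin (n + 1)) :
    #(vertices e (x l)) = n + 1 - l := by
  have h : codim e (x l) = l := congr_fun ((codim_strictMono e hK).comp x.strictMono).eq_id l
  have hle : #(vertices e (x l)) ≤ n + 1 := hK _ (OrderDual.ofDual (e (x l))).2
  have := congrArg Fin.val h
  simp only [codim] at this
  omega

omit hK

/-- The chain of faces attached to an ordered face of `K`. -/
def chain {d : Fin (n + 1) → P} (hd : IsOrderedFace K d) : Fin (n + 1) ↪o X :=
  OrderEmbedding.ofStrictMono (fun l => e.symm (OrderDual.toDual ⟨flag d l, flag_mem hd l⟩))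
    fun _ _ h => e.symm.lt_iff_lt.2 (flag_strictAnti hd.1 h)

lemma vertices_chain {d : Fin (n + 1) → P} (hd : IsOrderedFace K d) (l : Fin (n + 1)) :
    vertices e (chain e hd l) = flag d l :=
  congrArg (fun S => (OrderDual.ofDual S).1) (e.apply_symm_apply _)

include hK

lemma exists_chain_eq (x : Fin (n + 1) ↪o X) :
    ∃ (d : Fin (n + 1) → P) (hd : IsOrderedFace K d), chain e hd = x := by
  let S (l : ℕ) : Finset P := if h : l < n + 1 then vertices e (x ⟨l, h⟩) else ∅
  have hS : Antitone S := fun l m hlm => by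
    simp only [S]
    split_ifs with hm hl
    · exact (vertices_strictAnti e).antitone (x.monotone hlm)
    · omega
    · exact empty_subset _
    · exact le_rfl
  have hcard (l : ℕ) : #(S l) = n + 1 - l := by
    simp only [S]
    split_ifs with h
    · exact card_vertices e hK x _
    · simp [Nat.sub_eq_zero_of_le (not_lt.1 h)]
  obtain ⟨d, hd⟩ := exists_flag_eq hS hcard
  have himage : univ.image d = vertices e (x 0) := by
    rw [← flag_zero, hd]; simp [S]
  have hdK : IsOrderedFace K d := by
    refine ⟨Set.injOn_univ.1 ?_, himage ▸ (OrderDual.ofDual (e (x 0))).2⟩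
    rw [← coe_univ, ← card_image_iff, ← flag_zero, hd, hcard, card_univ, Fintype.card_fin,
      Nat.sub_zero]
  refine ⟨d, hdK, RelEmbedding.ext fun l => vertices_injective e ?_⟩
  rw [vertices_chain, hd]
  exact dif_pos l.2

/-- The strict chains of maximal length correspond to the ordered faces of maximal dimension. -/
noncomputable def chainEquiv : {d : Fin (n + 1) → P // IsOrderedFace K d} ≃ (Fin (n + 1) ↪o X) :=
  Equiv.ofBijective (fun d => chain e d.2)
    ⟨fun d d' h => Subtype.ext <| flag_injOn d.2.1 d'.2.1 <| funext fun l => by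
      rcases lt_or_ge l (n + 1) with hl | hl
      · simpa only [vertices_chain] using congr(vertices e ($h ⟨l, hl⟩))
      · rw [flag_of_le _ hl, flag_of_le _ hl],
    fun x => by
      obtain ⟨d, hd, rfl⟩ := exists_chain_eq e hK x
      exact ⟨⟨d, hd⟩, rfl⟩⟩

omit hK in
lemma face_chainEquiv_eq_iff {m : ℕ} (hK : ∀ S ∈ K, #S ≤ m + 2) (i : Fin (m + 2))
    (d d' : {d : Fin (m + 2) → P // IsOrderedFace K d}) :
    face i (chainEquiv e hK d') = face i (chainEquiv e hK d) ↔
      ∀ l ≠ (i : ℕ), flag d'.1 l = flag d.1 l := by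
  constructor
  · intro h l hl
    rcases lt_or_ge l (m + 2) with hlm | hlm
    · obtain ⟨l', hl'⟩ := Fin.exists_succAbove_eq (x := ⟨l, hlm⟩) (y := i) (by simpa [Fin.ext_iff])
      have : chain e d'.2 ⟨l, hlm⟩ = chain e d.2 ⟨l, hlm⟩ := hl' ▸ congr($h l')
      simpa only [vertices_chain] using congrArg (vertices e) this
    · rw [flag_of_le _ hlm, flag_of_le _ hlm]
  · refine fun h => RelEmbedding.ext fun l => vertices_injective e ?_
    exact (vertices_chain e d'.2 _).trans
      ((h _ (Fin.val_ne_of_ne (Fin.succAbove_ne i l))).trans (vertices_chain e d.2 _).symm)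

end Chains

section Cycles

universe u

variable {k P : Type u} [CommRing k] {n : ℕ}

lemma apply_comp_perm {F : (Fin (n + 2) → P) → k}
    (hF : ∀ d (j : Fin (n + 1)), F (d ∘ swap j.castSucc j.succ) = -F d) (d : Fin (n + 2) → P)
    (σ : Perm (Fin (n + 2))) : F (d ∘ σ) = Perm.sign σ • F d := by
  have hσ : σ ∈ Submonoid.closure (Set.range fun j : Fin (n + 1) => swap j.castSucc j.succ) :=
    Perm.mclosure_swap_castSucc_succ (n + 1) ▸ Submonoid.mem_top σ
  induction hσ using Submonoid.closure_induction generalizing d with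
  | mem _ hσ =>
    obtain ⟨j, rfl⟩ := hσ
    rw [hF, Perm.sign_swap Fin.castSucc_lt_succ.ne, Units.neg_smul, one_smul]
  | one => rw [Perm.coe_one, Function.comp_id, map_one, one_smul]
  | mul σ τ _ _ hσ hτ =>
    rw [Perm.coe_mul, ← Function.comp_assoc, hτ, hσ, map_mul, mul_smul, smul_comm]

variable [DecidableEq P] {K : PreAbstractSimplicialComplex P} {X : Type u} [PartialOrder X]
  (e : X ≃o (↥K)ᵒᵈ)

section TupleCoeff

variable (hK : ∀ S ∈ K, #S ≤ n + 1)

variable (k) in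
/-- Functions on the maximal chains of the face poset, regarded as functions on tuples of vertices
which vanish off the ordered faces. -/
noncomputable def tupleCoeff : ((Fin (n + 1) ↪o X) → k) →ₗ[k] (Fin (n + 1) → P) → k :=
  Function.ExtendByZero.linearMap k Subtype.val ∘ₗ LinearMap.funLeft k k (chainEquiv e hK)

lemma tupleCoeff_of_isOrderedFace (f : (Fin (n + 1) ↪o X) → k) {d : Fin (n + 1) → P}
    (hd : IsOrderedFace K d) : tupleCoeff k e hK f d = f (chain e hd) :=
  Subtype.val_injective.extend_apply _ _ (⟨d, hd⟩ : {d // IsOrderedFace K d})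

lemma tupleCoeff_of_not_isOrderedFace (f : (Fin (n + 1) ↪o X) → k) {d : Fin (n + 1) → P}
    (hd : ¬IsOrderedFace K d) : tupleCoeff k e hK f d = 0 :=
  Function.extend_apply' _ _ _ fun ⟨d', h⟩ => hd (h ▸ d'.2)

lemma tupleCoeff_injective : Function.Injective (tupleCoeff k e hK) := fun f g h => by
  funext x
  obtain ⟨d, hd, rfl⟩ := exists_chain_eq e hK x
  simpa only [tupleCoeff_of_isOrderedFace _ _ _ hd] using congr_fun h d

lemma exists_tupleCoeff_eq {F : (Fin (n + 1) → P) → k} (hF : ∀ d, ¬IsOrderedFace K d → F d = 0) :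
    ∃ f, tupleCoeff k e hK f = F := by
  refine ⟨fun x => F ((chainEquiv e hK).symm x).1, funext fun d => ?_⟩
  by_cases hd : IsOrderedFace K d
  · rw [tupleCoeff_of_isOrderedFace _ _ _ hd,
      show chain e hd = chainEquiv e hK ⟨d, hd⟩ from rfl, Equiv.symm_apply_apply]
  · rw [tupleCoeff_of_not_isOrderedFace _ _ _ hd, hF d hd]

end TupleCoeff

variable [Fintype P] [Finite X] (hK : ∀ S ∈ K, #S ≤ n + 2)

variable (k n K) in
/-- The simplicial cycles of dimension `n + 1` of a complex of the same dimension, as alternating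
functions on the tuples of vertices. -/
def alternatingCycles : Submodule k ((Fin (n + 2) → P) → k) where
  carrier := {F | (∀ d, ¬IsOrderedFace K d → F d = 0) ∧
    (∀ d (σ : Perm (Fin (n + 2))), F (d ∘ σ) = Perm.sign σ • F d) ∧
    ∀ d, ∑ p, F (Function.update d 0 p) = 0}
  add_mem' hF hG :=
    ⟨fun d hd => by rw [Pi.add_apply, hF.1 d hd, hG.1 d hd, add_zero],
      fun d σ => by rw [Pi.add_apply, Pi.add_apply, hF.2.1, hG.2.1, smul_add],
      fun d => by simp only [Pi.add_apply, sum_add_distrib, hF.2.2, hG.2.2, add_zero]⟩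
  zero_mem' := ⟨fun _ _ => rfl, fun _ _ => (smul_zero _).symm, fun _ => sum_const_zero⟩
  smul_mem' c F hF :=
    ⟨fun d hd => by rw [Pi.smul_apply, hF.1 d hd, smul_zero],
      fun d σ => by rw [Pi.smul_apply, Pi.smul_apply, hF.2.1, smul_comm],
      fun d => by simp only [Pi.smul_apply, ← smul_sum, hF.2.2, smul_zero]⟩

open Classical in
lemma sum_face_eq (f : (Fin (n + 2) ↪o X) → k) {d : Fin (n + 2) → P} (hd : IsOrderedFace K d)
    (i : Fin (n + 2)) :
    ∑ y with face i y = face i (chain e hd), f y =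
      ∑ d' : Fin (n + 2) → P with Function.Injective d' ∧ ∀ l ≠ (i : ℕ), flag d' l = flag d l,
        tupleCoeff k e hK f d' := by
  have hface (d' : {d : Fin (n + 2) → P // IsOrderedFace K d}) :=
    face_chainEquiv_eq_iff e hK i ⟨d, hd⟩ d'
  refine sum_of_injOn (fun y => ((chainEquiv e hK).symm y).1)
    (Subtype.val_injective.comp (chainEquiv e hK).symm.injective).injOn ?_ ?_ ?_
  · intro y hy
    obtain ⟨d', rfl⟩ := (chainEquiv e hK).surjective y
    refine (mem_filter_univ _).2 ?_
    simp only [Equiv.symm_apply_apply]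
    exact ⟨d'.2.1, (hface d').1 ((mem_filter_univ (chainEquiv e hK d')).1 hy)⟩
  · intro d' hd' hnot
    refine tupleCoeff_of_not_isOrderedFace _ _ _ fun h => hnot ?_
    exact ⟨chainEquiv e hK ⟨d', h⟩,
      (mem_filter_univ _).2 ((hface ⟨d', h⟩).2 ((mem_filter_univ _).1 hd').2), by simp⟩
  · intro y _
    obtain ⟨d', rfl⟩ := (chainEquiv e hK).surjective y
    rw [Equiv.symm_apply_apply, tupleCoeff_of_isOrderedFace _ _ _ d'.2]
    rfl

open Classical in
lemma sum_face_zero_eq (f : (Fin (n + 2) ↪o X) → k) {d : Fin (n + 2) → P}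
    (hd : IsOrderedFace K d) :
    ∑ y with face 0 y = face 0 (chain e hd), f y =
      ∑ p, tupleCoeff k e hK f (Function.update d 0 p) := by
  rw [sum_face_eq e hK f hd]
  have hupdate {d' : Fin (n + 2) → P}
      (h : Function.Injective d' ∧ ∀ l ≠ 0, flag d' l = flag d l) :
      d' = Function.update d 0 (d' 0) := eq_update_of_flag_eq h.1 h.2
  refine sum_of_injOn (fun d' => d' 0) ?_ (fun _ _ => mem_coe.2 (mem_univ _)) ?_ ?_
  · intro d₁ h₁ d₂ h₂ h
    rw [hupdate ((mem_filter_univ d₁).1 h₁), hupdate ((mem_filter_univ d₂).1 h₂)]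
    exact congrArg _ h
  · intro p _ hp
    refine tupleCoeff_of_not_isOrderedFace _ _ _ fun h => hp ?_
    exact ⟨Function.update d 0 p,
      (mem_filter_univ _).2 ⟨h.1, fun l hl => flag_update_zero d p hl⟩, by simp⟩
  · exact fun d' hd' => congrArg _ (hupdate ((mem_filter_univ d').1 hd'))

open Classical in
omit [Fintype P] in
lemma sum_face_succ_eq [Finite P] (f : (Fin (n + 2) ↪o X) → k) {d : Fin (n + 2) → P}
    (hd : IsOrderedFace K d) (j : Fin (n + 1)) :
    ∑ y with face j.succ y = face j.succ (chain e hd), f y =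
      tupleCoeff k e hK f d + tupleCoeff k e hK f (d ∘ swap j.castSucc j.succ) := by
  have := Fintype.ofFinite P
  have hne : d ≠ d ∘ swap j.castSucc j.succ := fun h =>
    Fin.castSucc_lt_succ.ne (hd.1 (by simpa using congr_fun h j.castSucc))
  rw [sum_face_eq e hK f hd, ← sum_pair hne]
  refine sum_congr (ext fun d' => ?_) fun _ _ => rfl
  rw [mem_filter_univ, mem_insert, mem_singleton]
  refine ⟨fun h => eq_or_eq_comp_swap_of_flag_eq h.1 h.2, ?_⟩
  rintro (rfl | rfl)
  · exact ⟨hd.1, fun _ _ => rfl⟩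
  · refine ⟨hd.1.comp (swap _ _).injective, fun l hl => flag_comp_perm d _ fun i hi => ?_⟩
    grind

lemma tupleCoeff_mem_alternatingCycles {f : (Fin (n + 2) ↪o X) → k} :
    tupleCoeff k e hK f ∈ alternatingCycles k n K ↔ f ∈ topCycles k X n := by
  classical
  constructor
  · rintro ⟨-, halt, hsum⟩ i x
    obtain ⟨d, hd, rfl⟩ := exists_chain_eq e hK x
    refine Fin.cases ?_ (fun j => ?_) i
    · exact (sum_face_zero_eq e hK f hd).trans (hsum d)
    · rw [sum_face_succ_eq e hK f hd, halt, Perm.sign_swap Fin.castSucc_lt_succ.ne,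
        Units.neg_smul, one_smul, add_neg_cancel]
  · intro hf
    refine ⟨fun d => tupleCoeff_of_not_isOrderedFace e hK f, apply_comp_perm fun d j => ?_,
      fun d => ?_⟩
    · by_cases hd : IsOrderedFace K d
      · rw [eq_neg_iff_add_eq_zero, add_comm, ← sum_face_succ_eq e hK f hd]
        convert hf j.succ (chain e hd)
      · have hd' : ¬IsOrderedFace K (d ∘ swap j.castSucc j.succ) := fun h => hd <| by
          simpa [Function.comp_assoc, ← Perm.coe_mul] using h.comp_perm (swap j.castSucc j.succ)
        rw [tupleCoeff_of_not_isOrderedFace e hK f hd, neg_zero,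
          tupleCoeff_of_not_isOrderedFace e hK f hd']
    · by_cases! h : ∃ p, IsOrderedFace K (Function.update d 0 p)
      · obtain ⟨p, hp⟩ := h
        have := (sum_face_zero_eq e hK f hp).symm.trans (hf 0 (chain e hp))
        simpa only [Function.update_idem] using this
      · exact sum_eq_zero fun p _ => tupleCoeff_of_not_isOrderedFace e hK f (h p)

variable (k) in
/-- The homology of top degree of a finite complex, computed from the order complex of the opposite
of its face poset. -/
noncomputable def homologyEquiv : nerveHomology k X (n + 1) ≃ₗ[k] alternatingCycles k n K :=
  LinearEquiv.ofBijective
    ((tupleCoeff k e hK ∘ₗ topCoeff k (codim_strictMono e hK)).codRestrict _ fun z =>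
      (tupleCoeff_mem_alternatingCycles e hK).2 <|
        range_topCoeff k (codim_strictMono e hK) ▸ ⟨z, rfl⟩)
    ⟨fun z w h => topCoeff_injective k _ (tupleCoeff_injective e hK (congrArg Subtype.val h)),
      fun F => by
        obtain ⟨f, hf⟩ := exists_tupleCoeff_eq e hK F.2.1
        obtain ⟨z, rfl⟩ : f ∈ LinearMap.range (topCoeff k (codim_strictMono e hK)) := by
          rw [range_topCoeff, ← tupleCoeff_mem_alternatingCycles e hK, hf]
          exact F.2
        exact ⟨z, Subtype.ext hf⟩⟩

omit [Fintype P] [Finite X] in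
lemma isOrderedFace_perm_comp_iff (φ : X ≃o X) {π : Perm P}
    (hφ : ∀ x, vertices e (φ x) = (vertices e x).map π.toEmbedding) {m : ℕ} {d : Fin m → P} :
    IsOrderedFace K (π ∘ d) ↔ IsOrderedFace K d := by
  have hvertices {S : Finset P} (hS : S ∈ K) : ∃ x, vertices e x = S :=
    ⟨e.symm (OrderDual.toDual ⟨S, hS⟩), congrArg (fun S => (OrderDual.ofDual S).1)
      (e.apply_symm_apply _)⟩
  have hmap (S : Finset P) : S.map π.toEmbedding ∈ K ↔ S ∈ K := by
    constructor <;> intro hS <;> obtain ⟨x, hx⟩ := hvertices hS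
    · rw [← φ.apply_symm_apply x, hφ] at hx
      exact map_injective _ hx ▸ (OrderDual.ofDual (e (φ.symm x))).2
    · rw [← hx, ← hφ]
      exact (OrderDual.ofDual (e (φ x))).2
  rw [IsOrderedFace, IsOrderedFace, π.injective.of_comp_iff, ← image_image, ← hmap (image d univ),
    map_eq_image]
  rfl

lemma homologyEquiv_homologyMap (φ : X ≃o X) {π : Perm P}
    (hφ : ∀ x, vertices e (φ x) = (vertices e x).map π.toEmbedding)
    (z : nerveHomology k X (n + 1)) (d : Fin (n + 2) → P) :
    (homologyEquiv k e hK ((SSet.homologyMap (nerveMap φ.monotone.functor)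
      (ModuleCat.of k k) (n + 1)).hom z)).1 (π ∘ d) = (homologyEquiv k e hK z).1 d := by
  by_cases hd : IsOrderedFace K d
  · have hd' : IsOrderedFace K (π ∘ d) := (isOrderedFace_perm_comp_iff e φ hφ).2 hd
    have hchain : chain e hd' = (chain e hd).trans φ.toOrderEmbedding :=
      RelEmbedding.ext fun l => vertices_injective e <| by
        rw [vertices_chain, flag, ← image_image, ← flag, ← vertices_chain e hd]
        exact (map_eq_image π.toEmbedding _).symm.trans (hφ _).symm
    refine (tupleCoeff_of_isOrderedFace e hK _ hd').trans ?_
    rw [hchain]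
    exact (topCoeff_homologyMap k (codim_strictMono e hK) (codim_strictMono e hK)
      φ.toOrderEmbedding z _).trans (tupleCoeff_of_isOrderedFace e hK _ hd).symm
  · rw [(homologyEquiv k e hK z).2.1 d hd,
      (homologyEquiv k e hK _).2.1 _ ((isOrderedFace_perm_comp_iff e φ hφ).not.2 hd)]

end Cycles

end FacePoset

namespace FacePoset

open Finset
open Equiv (Perm swap)

universe u

section Exchange

variable {k P : Type u} [CommRing k] [DecidableEq P] {n : ℕ}

lemma image_update {d : Fin n → P} (hd : Function.Injective d) (i : Fin n) (y : P) :
    univ.image (Function.update d i y) = insert y ((univ.image d).erase (d i)) := by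
  rw [← image_erase hd, ← insert_erase (mem_univ i), image_insert, Function.update_self,
    erase_insert_eq_erase, erase_idem]
  congr 1
  exact image_congr fun j hj => Function.update_of_ne (ne_of_mem_erase hj) _ _

lemma exists_comp_perm_eq {d e : Fin n → P} (he : Function.Injective e)
    (h : univ.image e = univ.image d) : ∃ π : Perm (Fin n), d ∘ π = e := by
  have hd : Function.Injective d := by
    rw [← Set.injOn_univ, ← coe_univ, ← card_image_iff, ← h, card_image_of_injective _ he]
  have hrange : Set.range e = Set.range d := by simpa using congr_arg SetLike.coe h
  exact ⟨(Equiv.ofInjective e he).trans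
      ((Equiv.setCongr hrange).trans (Equiv.ofInjective d hd).symm), funext fun i =>
    Equiv.apply_ofInjective_symm hd (Equiv.setCongr hrange (Equiv.ofInjective e he i))⟩

variable [Fintype P] {K : PreAbstractSimplicialComplex P} {F : (Fin (n + 2) → P) → k}

lemma apply_eq_zero_of_not_injective (hF : F ∈ alternatingCycles k n K) {d : Fin (n + 2) → P}
    (hd : ¬Function.Injective d) : F d = 0 :=
  hF.1 d fun h => hd h.1

lemma apply_eq_zero_of_image_eq (hF : F ∈ alternatingCycles k n K) {d e : Fin (n + 2) → P}
    (h : univ.image e = univ.image d) (hd : F d = 0) : F e = 0 := by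
  by_cases he : Function.Injective e
  · obtain ⟨π, rfl⟩ := exists_comp_perm_eq he h
    rw [hF.2.1, hd, smul_zero]
  · exact apply_eq_zero_of_not_injective hF he

/-- The function `F` on tuples vanishes at all orderings of the set `S`. -/
def VanishesOn (F : (Fin (n + 2) → P) → k) (S : Finset P) : Prop :=
  ∀ d, univ.image d = S → F d = 0

lemma vanishesOn_image (hF : F ∈ alternatingCycles k n K) {d : Fin (n + 2) → P} (hd : F d = 0) :
    VanishesOn F (univ.image d) :=
  fun _ he => apply_eq_zero_of_image_eq hF he hd

lemma vanishesOn_of_notMem (hF : F ∈ alternatingCycles k n K) {S : Finset P} (hS : S ∉ K) :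
    VanishesOn F S :=
  fun d hd => hF.1 d fun h => hS (hd ▸ h.2)

/-- The cycle condition on `S \ {x}` determines the value on `S` from the values on the sets
obtained by exchanging `x` for a point off `S`. -/
lemma vanishesOn_of_exchange (hF : F ∈ alternatingCycles k n K) {S : Finset P} {x : P}
    (hx : x ∈ S) (h : ∀ y ∉ S, VanishesOn F (insert y (S.erase x))) : VanishesOn F S := by
  rintro d rfl
  by_cases hd : Function.Injective d
  · obtain ⟨i, -, rfl⟩ := mem_image.1 hx
    set d' := d ∘ swap 0 i
    have hd' : Function.Injective d' := hd.comp (swap 0 i).injective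
    have himage : univ.image d' = univ.image d := by
      rw [← image_image, image_univ_equiv]
    have hother : ∀ y ≠ d' 0, F (Function.update d' 0 y) = 0 := fun y hy => by
      by_cases hyd : y ∈ univ.image d'
      · obtain ⟨j, -, rfl⟩ := mem_image.1 hyd
        refine apply_eq_zero_of_not_injective hF fun hinj => hy ?_
        have hj : j ≠ 0 := fun hj => hy (by rw [hj])
        exact absurd (hinj (a₁ := 0) (a₂ := j) (by simp [hj])) hj.symm
      · refine h y (himage ▸ hyd) _ ?_
        rw [image_update hd', himage, show d' 0 = d i by simp [d']]
    have hzero : F d' = 0 := by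
      rw [← hF.2.2 d', Fintype.sum_eq_single _ hother, Function.update_eq_self]
    exact apply_eq_zero_of_image_eq hF himage.symm hzero
  · exact apply_eq_zero_of_not_injective hF hd

end Exchange

section Construction

variable {P : Type} [DecidableEq P] [Fintype P] {n : ℕ} {K : PreAbstractSimplicialComplex P}

lemma intCast_mem_alternatingCycles {k : Type} [CommRing k] {F : (Fin (n + 2) → P) → ℤ}
    (hF : F ∈ alternatingCycles ℤ n K) : (fun d => (F d : k)) ∈ alternatingCycles k n K := by
  refine ⟨fun d hd => by simp only [hF.1 d hd, Int.cast_zero], fun d σ => ?_, fun d => ?_⟩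
  · simp only [hF.2.1, Units.smul_def, smul_eq_mul, zsmul_eq_mul, Int.cast_mul]
  · rw [← Int.cast_sum, hF.2.2, Int.cast_zero]

lemma mem_alternatingCycles_of_swap {k : Type} [CommRing k] [NoZeroDivisors k] [CharZero k]
    {F : (Fin (n + 2) → P) → k}
    (hface : ∀ S ∉ K, #S = n + 2 → ∃ d, univ.image d = S ∧ F d = 0)
    (hswap : ∀ d (j : Fin (n + 1)), F (d ∘ swap j.castSucc j.succ) = -F d)
    (hsum : ∀ d, ∑ p, F (Function.update d 0 p) = 0) : F ∈ alternatingCycles k n K := by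
  refine ⟨fun d hd => ?_, apply_comp_perm hswap, hsum⟩
  by_cases hinj : Function.Injective d
  · obtain ⟨e, he, hFe⟩ := hface _ (fun hK => hd ⟨hinj, hK⟩)
      (by rw [card_image_of_injective _ hinj, card_fin])
    obtain ⟨π, rfl⟩ := exists_comp_perm_eq hinj he.symm
    rw [apply_comp_perm hswap, hFe, smul_zero]
  · obtain ⟨i, j, hij, hne⟩ := Function.not_injective_iff.1 hinj
    have hd : d ∘ swap i j = d := by
      rw [Equiv.comp_swap_eq_update, hij, Function.update_eq_self, ← hij, Function.update_eq_self]
    have hneg := apply_comp_perm hswap d (swap i j)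
    rw [hd, Equiv.Perm.sign_swap hne, Units.neg_smul, one_smul] at hneg
    exact self_eq_neg.1 hneg

end Construction

section Pfaffian

variable {P R : Type*} [CommRing R]

/-- The Pfaffian of the `4 × 4` submatrix of the form `b` with rows and columns `d`. -/
def pfaffian (b : P → P → R) (d : Fin 4 → P) : R :=
  b (d 0) (d 1) * b (d 2) (d 3) - b (d 0) (d 2) * b (d 1) (d 3) + b (d 0) (d 3) * b (d 1) (d 2)

variable {b : P → P → R}

lemma pfaffian_comp_swap (hb : ∀ x y, b y x = -b x y) (d : Fin 4 → P) (j : Fin 3) :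
    pfaffian b (d ∘ swap j.castSucc j.succ) = -pfaffian b d := by
  fin_cases j <;> simp [pfaffian, Equiv.swap_apply_def]
  · linear_combination b (d 2) (d 3) * hb (d 0) (d 1)
  · linear_combination b (d 0) (d 3) * hb (d 1) (d 2)
  · linear_combination b (d 0) (d 1) * hb (d 2) (d 3)

lemma sum_pfaffian_update [Fintype P] (hb : ∀ y, ∑ x, b x y = 0) (d : Fin 4 → P) :
    ∑ x, pfaffian b (Function.update d 0 x) = 0 := by
  simp [pfaffian, sum_add_distrib, ← sum_mul, hb]

end Pfaffian

end FacePoset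

namespace WeightVector

open Module Representation

variable {k G V W : Type*} [Field k] [Group G] [AddCommGroup V] [Module k V] [AddCommGroup W]
  [Module k W] {H : Subgroup G}

/-- The vector `v` transforms under the subgroup `H` by the character `χ`. -/
def IsWeightVector (ρ : Representation k G V) (χ : H →* kˣ) (v : V) : Prop :=
  ∀ h : H, ρ h v = (χ h : k) • v

/-- Mackey's criterion, for a character `χ` of `H`: the conjugate of `χ` by an element outside `H`
differs from `χ` already where both are defined. -/
def SatisfiesMackey (χ : H →* kˣ) : Prop :=
  ∀ g ∉ H, ∃ a b : H, (a : G) * g = g * b ∧ χ a ≠ χ b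

section Generators

variable {ρ : Representation k G V} {S : Set G}

lemma apply_inv_eq_smul {g : G} {c : kˣ} {v : V} (h : ρ g v = (c : k) • v) :
    ρ g⁻¹ v = ((c⁻¹ : kˣ) : k) • v :=
  calc ρ g⁻¹ v = ((c⁻¹ : kˣ) : k) • (c : k) • ρ g⁻¹ v := by
        rw [smul_smul, Units.inv_mul, one_smul]
    _ = ((c⁻¹ : kˣ) : k) • v := by rw [← map_smul, ← h, inv_self_apply]

lemma exists_isWeightVector {v : V} (hv : v ≠ 0) (hS : ∀ s ∈ S, ∃ c : k, ρ s v = c • v) :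
    ∃ χ : Subgroup.closure S →* kˣ, IsWeightVector ρ χ v := by
  have hne (g : G) {c : k} (h : ρ g v = c • v) : c ≠ 0 := by
    rintro rfl
    exact hv ((ρ.apply_bijective g).1 (by rw [h, zero_smul, map_zero]))
  have hscale (g : G) (hg : g ∈ Subgroup.closure S) : ∃ c : kˣ, ρ g v = (c : k) • v := by
    induction hg using Subgroup.closure_induction with
    | mem s hs =>
      obtain ⟨c, hc⟩ := hS s hs
      exact ⟨Units.mk0 c (hne s hc), hc⟩
    | one => exact ⟨1, by simp⟩
    | mul x y _ _ hx hy =>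
      obtain ⟨c, hc⟩ := hx
      obtain ⟨d, hd⟩ := hy
      exact ⟨c * d, by rw [map_mul, End.mul_apply, hd, map_smul, hc, smul_smul, mul_comm,
        Units.val_mul]⟩
    | inv x _ hx =>
      obtain ⟨c, hc⟩ := hx
      exact ⟨c⁻¹, apply_inv_eq_smul hc⟩
  choose c hc using hscale
  refine ⟨MonoidHom.mk' (fun g => c g g.2) fun g h => Units.ext ?_, fun g => hc g g.2⟩
  refine smul_left_injective k hv ?_
  change (c (g * h : G) _ : k) • v = ((c g _ : k) * c h _) • v
  rw [← hc, map_mul, End.mul_apply, hc h h.2, map_smul, hc g g.2, smul_smul, mul_comm]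

lemma isWeightVector_of_generators {χ : Subgroup.closure S →* kˣ} {v : V}
    (hS : ∀ s (hs : s ∈ S), ρ s v = (χ ⟨s, Subgroup.subset_closure hs⟩ : k) • v) :
    IsWeightVector ρ χ v := by
  rintro ⟨g, hg⟩
  induction hg using Subgroup.closure_induction with
  | mem s hs => exact hS s hs
  | one =>
    change ρ 1 v = ((χ 1 : kˣ) : k) • v
    rw [map_one, map_one, End.one_apply, Units.val_one, one_smul]
  | mul x y hx hy ihx ihy =>
    rw [map_mul, End.mul_apply, ihy, map_smul, ihx, smul_smul, mul_comm, ← Units.val_mul, ← map_mul]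
    rfl
  | inv x hx ih =>
    change ρ x⁻¹ v = (χ (⟨x, hx⟩⁻¹) : k) • v
    rw [map_inv χ]
    exact apply_inv_eq_smul ih

end Generators

/-- The subrepresentation generated by a vector. -/
def orbitSpan (ρ : Representation k G V) (v : V) : Subrepresentation ρ where
  toSubmodule := Submodule.span k (Set.range fun g => ρ g v)
  apply_mem_toSubmodule g w hw := by
    rw [← Submodule.mem_comap]
    refine Submodule.span_le.2 ?_ hw
    rintro _ ⟨h, rfl⟩
    exact Submodule.subset_span ⟨g * h, by simp only [map_mul, End.mul_apply]⟩

lemma orbitSpan_le {ρ : Representation k G V} {v : V} {M : Subrepresentation ρ} (hv : v ∈ M) :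
    orbitSpan ρ v ≤ M := by
  refine Submodule.span_le.2 ?_
  rintro _ ⟨g, rfl⟩
  exact M.apply_mem_toSubmodule g hv

lemma mem_orbitSpan (ρ : Representation k G V) (v : V) : v ∈ orbitSpan ρ v :=
  Submodule.subset_span ⟨1, by simp only [map_one, End.one_apply]⟩

lemma orbitSpan_eq_top {ρ : Representation k G V} (hρ : ρ.IsIrreducible) {v : V} (hv : v ≠ 0) :
    orbitSpan ρ v = ⊤ :=
  (hρ.eq_bot_or_eq_top _).resolve_left fun h => hv <| (Submodule.mem_bot k).1 <|
    (h ▸ mem_orbitSpan ρ v : v ∈ (⊥ : Subrepresentation ρ))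

/-- The translates of `v` by representatives of the left cosets of `H`. -/
noncomputable def translate (H : Subgroup G) (ρ : Representation k G V) (v : V) (x : G ⧸ H) : V :=
  ρ x.out v

section Translates

variable {ρ : Representation k G V} {χ : H →* kˣ} {v : V} (hv : IsWeightVector ρ χ v)

include hv

lemma apply_eq_smul_translate (g : G) {h : H} (hg : (g : G ⧸ H).out = g * h) :
    ρ g v = (χ h⁻¹ : k) • translate H ρ v g := by
  have hg' : g = (g : G ⧸ H).out * (h⁻¹ : H) := by
    rw [hg, Subgroup.coe_inv, mul_inv_cancel_right]
  conv_lhs => rw [hg', map_mul, End.mul_apply, hv, map_smul]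
  rfl

lemma orbitSpan_toSubmodule_eq :
    (orbitSpan ρ v).toSubmodule = Submodule.span k (Set.range (translate H ρ v)) := by
  refine le_antisymm (Submodule.span_le.2 ?_) (Submodule.span_mono ?_)
  · rintro _ ⟨g, rfl⟩
    obtain ⟨h, hg⟩ := QuotientGroup.mk_out_eq_mul H g
    change ρ g v ∈ _
    rw [apply_eq_smul_translate hv g hg]
    exact Submodule.smul_mem _ _ (Submodule.subset_span ⟨g, rfl⟩)
  · rintro _ ⟨x, rfl⟩
    exact ⟨x.out, rfl⟩

lemma top_le_span_translate (hρ : ρ.IsIrreducible) (hv0 : v ≠ 0) :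
    ⊤ ≤ Submodule.span k (Set.range (translate H ρ v)) := by
  rw [← orbitSpan_toSubmodule_eq hv, orbitSpan_eq_top hρ hv0]
  exact le_rfl

end Translates

/-- If the dimension were at least the index of `H`, the translates of `v` would be a basis permuted
by `G`, and their sum would be a nonzero invariant. -/
lemma finrank_lt_index [H.FiniteIndex] {ρ : Representation k G V} (hρ : ρ.IsIrreducible)
    (hV : 1 < finrank k V) {v : V} (hv0 : v ≠ 0)
    (hv : IsWeightVector ρ (1 : H →* kˣ) v) : finrank k V < H.index := by
  by_contra! hle
  have := Fintype.ofFinite (G ⧸ H)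
  have hcard : Fintype.card (G ⧸ H) = finrank k V := by
    refine le_antisymm ?_ ?_
    · rwa [← Nat.card_eq_fintype_card]
    · rw [← finrank_top k V, ← top_le_iff.1 (top_le_span_translate hv hρ hv0)]
      exact finrank_range_le_card _
  have hind : LinearIndependent k (translate H ρ v) :=
    linearIndependent_of_top_le_span_of_card_eq_finrank (top_le_span_translate hv hρ hv0) hcard
  have hinv (g : G) : ρ g (∑ x, translate H ρ v x) = ∑ x, translate H ρ v x := by
    rw [map_sum]
    refine Fintype.sum_equiv (MulAction.toPerm g) _ _ fun x => ?_
    obtain ⟨h, hg⟩ := QuotientGroup.mk_out_eq_mul H (g * x.out)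
    have := apply_eq_smul_translate hv _ hg
    rw [map_mul, End.mul_apply, MonoidHom.one_apply, Units.val_one, one_smul] at this
    rw [translate, this, MulAction.toPerm_apply]
    exact congrArg _ (by rw [← smul_eq_mul, ← MulAction.Quotient.smul_coe, QuotientGroup.out_eq'])
  have hsum : ∑ x, translate H ρ v x ≠ 0 := fun h => one_ne_zero <|
    Fintype.linearIndependent_iff.1 hind (fun _ => (1 : k)) (by simpa using h) (1 : G)
  have htop := congrArg Subrepresentation.toSubmodule (orbitSpan_eq_top hρ hsum)
  rw [orbitSpan] at htop
  simp only [hinv, Set.range_const] at htop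
  have := finrank_span_singleton (K := k) hsum
  rw [htop] at this
  exact hV.ne (this.symm.trans (finrank_top k V))

section Mackey

variable {ρ : Representation k G V} {χ : H →* kˣ} {v : V}

section Projection

variable [Fintype H]

/-- `|H|` times the projection to the space of vectors of weight `χ`. -/
noncomputable def weightProjection (ρ : Representation k G V) (χ : H →* kˣ) : V →ₗ[k] V :=
  ∑ h : H, (χ h⁻¹ : k) • ρ h

lemma weightProjection_apply_apply (h : H) (w : V) :
    weightProjection ρ χ (ρ h w) = (χ h : k) • weightProjection ρ χ w := by
  simp only [weightProjection, LinearMap.sum_apply, LinearMap.smul_apply, Finset.smul_sum]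
  refine Fintype.sum_equiv (Equiv.mulRight h) _ _ fun a => ?_
  rw [Equiv.coe_mulRight, smul_smul, ← Units.val_mul, ← map_mul, mul_inv_rev, mul_inv_cancel_left,
    ← End.mul_apply, ← map_mul]
  rfl

lemma weightProjection_mem {M : Subrepresentation ρ} {w : V} (hw : w ∈ M) :
    weightProjection ρ χ w ∈ M := by
  rw [weightProjection, LinearMap.sum_apply]
  exact Submodule.sum_mem M.toSubmodule fun h _ =>
    M.toSubmodule.smul_mem _ (M.apply_mem_toSubmodule h hw)

variable (hv : IsWeightVector ρ χ v)

include hv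

lemma weightProjection_apply_self :
    weightProjection ρ χ v = (Nat.card H : k) • v := by
  simp only [weightProjection, LinearMap.sum_apply, LinearMap.smul_apply, hv _, smul_smul,
    ← Units.val_mul, ← map_mul, inv_mul_cancel, map_one, Units.val_one, one_smul, Finset.sum_const,
    Finset.card_univ, Nat.card_eq_fintype_card, Nat.cast_smul_eq_nsmul]

lemma weightProjection_apply_of_notMem (hχ : SatisfiesMackey χ) {g : G} (hg : g ∉ H) :
    weightProjection ρ χ (ρ g v) = 0 := by
  obtain ⟨a, b, hab, hne⟩ := hχ g hg
  by_contra h0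
  refine hne (Units.ext (smul_left_injective k h0 ?_))
  change (χ a : k) • weightProjection ρ χ (ρ g v) = (χ b : k) • weightProjection ρ χ (ρ g v)
  rw [← weightProjection_apply_apply, ← End.mul_apply (ρ a) (ρ g), ← map_mul, hab,
    map_mul, End.mul_apply, hv, map_smul, map_smul]

lemma weightProjection_translate [DecidableEq (G ⧸ H)] (hχ : SatisfiesMackey χ) (x y : G ⧸ H) :
    weightProjection ρ χ (ρ x.out⁻¹ (translate H ρ v y)) =
      if y = x then (Nat.card H : k) • v else 0 := by
  rw [translate, ← End.mul_apply (ρ x.out⁻¹), ← map_mul]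
  split_ifs with h
  · rw [h, inv_mul_cancel, map_one, End.one_apply, weightProjection_apply_self hv]
  · refine weightProjection_apply_of_notMem hv hχ fun hmem => h ?_
    rw [← x.out_eq', ← y.out_eq', eq_comm]
    exact QuotientGroup.eq.2 hmem

lemma weightProjection_sum_translate [Fintype (G ⧸ H)] (hχ : SatisfiesMackey χ)
    (c : G ⧸ H → k) (x : G ⧸ H) :
    weightProjection ρ χ (ρ x.out⁻¹ (∑ y, c y • translate H ρ v y)) =
      c x • (Nat.card H : k) • v := by
  classical
  simp only [map_sum, map_smul, weightProjection_translate hv hχ, smul_ite, smul_zero,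
    Finset.sum_ite_eq', Finset.mem_univ, if_true]

end Projection

variable [Finite H] [H.FiniteIndex] (hH : (Nat.card H : k) ≠ 0) (hχ : SatisfiesMackey χ)
  (hv : IsWeightVector ρ χ v) (hv0 : v ≠ 0)

include hH hχ hv hv0

lemma linearIndependent_translate : LinearIndependent k (translate H ρ v) := by
  have := Fintype.ofFinite H
  have := Fintype.ofFinite (G ⧸ H)
  refine Fintype.linearIndependent_iff.2 fun c hc x => ?_
  have := weightProjection_sum_translate hv hχ c x
  rw [hc, map_zero, map_zero, eq_comm] at this
  exact (smul_eq_zero.1 this).resolve_right (smul_ne_zero hH hv0)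

lemma isIrreducible_of_orbitSpan_eq_top (htop : orbitSpan ρ v = ⊤) : ρ.IsIrreducible := by
  have := Fintype.ofFinite H
  have := Fintype.ofFinite (G ⧸ H)
  have : Nontrivial (Subrepresentation ρ) := ⟨⊥, ⊤, fun h => hv0 <| (Submodule.mem_bot k).1 <|
    (h ▸ Submodule.mem_top : v ∈ (⊥ : Subrepresentation ρ))⟩
  refine ⟨fun M => or_iff_not_imp_left.2 fun hM => ?_⟩
  suffices v ∈ M from top_le_iff.1 (htop ▸ orbitSpan_le this)
  obtain ⟨w, hw, hw0⟩ : ∃ w ∈ M.toSubmodule, w ≠ 0 :=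
    Submodule.exists_mem_ne_zero_of_ne_bot fun h => hM (Subrepresentation.toSubmodule_injective h)
  obtain ⟨c, rfl⟩ : ∃ c : G ⧸ H → k, ∑ x, c x • translate H ρ v x = w := by
    rw [← Submodule.mem_span_range_iff_exists_fun, ← orbitSpan_toSubmodule_eq hv, htop]
    exact Submodule.mem_top
  obtain ⟨x, -, hx⟩ := Finset.exists_ne_zero_of_sum_ne_zero hw0
  have hmem := weightProjection_mem (χ := χ) (M.apply_mem_toSubmodule x.out⁻¹ hw)
  rw [weightProjection_sum_translate hv hχ] at hmem
  exact ((Submodule.smul_mem_iff _ (smul_ne_zero_iff.1 hx).1).trans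
    (Submodule.smul_mem_iff _ hH)).1 hmem

lemma index_le_finrank [FiniteDimensional k V] : H.index ≤ finrank k V := by
  have := Fintype.ofFinite (G ⧸ H)
  rw [Subgroup.index, Nat.card_eq_fintype_card]
  exact (linearIndependent_translate hH hχ hv hv0).fintype_card_le_finrank

lemma isIrreducible_of_finrank_eq (hV : finrank k V = H.index) : ρ.IsIrreducible := by
  have := Fintype.ofFinite (G ⧸ H)
  have : FiniteDimensional k V :=
    finite_of_finrank_pos (hV ▸ Nat.pos_of_ne_zero Subgroup.FiniteIndex.index_ne_zero)
  refine isIrreducible_of_orbitSpan_eq_top hH hχ hv hv0 (Subrepresentation.toSubmodule_injective ?_)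
  rw [orbitSpan_toSubmodule_eq hv]
  exact (linearIndependent_translate hH hχ hv hv0).span_eq_top_of_card_eq_finrank'
    (by rw [hV, Subgroup.index, Nat.card_eq_fintype_card])

lemma nonempty_equiv (hρ : ρ.IsIrreducible) {τ : Representation k G W} (hτ : τ.IsIrreducible)
    {w : W} (hw : IsWeightVector τ χ w) (hw0 : w ≠ 0) : Nonempty (ρ.Equiv τ) := by
  let b := Basis.mk (linearIndependent_translate hH hχ hv hv0) (top_le_span_translate hv hρ hv0)
  let c := Basis.mk (linearIndependent_translate hH hχ hw hw0) (top_le_span_translate hw hτ hw0)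
  let e := b.equiv c (Equiv.refl _)
  have htranslate (x : G ⧸ H) : e (translate H ρ v x) = translate H τ w x := by
    simpa only [b, c, Basis.mk_apply, Equiv.refl_apply] using b.equiv_apply x c (Equiv.refl _)
  have he (g : G) : e (ρ g v) = τ g w := by
    obtain ⟨h, hg⟩ := QuotientGroup.mk_out_eq_mul H g
    rw [apply_eq_smul_translate hv g hg, apply_eq_smul_translate hw g hg, map_smul, htranslate]
  refine ⟨Representation.Equiv.mk e fun g => b.ext fun x => ?_⟩
  simp only [b, Basis.mk_apply, LinearMap.comp_apply, LinearEquiv.coe_coe, translate, he]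
  rw [← End.mul_apply, ← map_mul, he, map_mul, End.mul_apply]

end Mackey

section Character

variable {ρ : Representation k G V}

lemma card_dvd_finrank [FiniteDimensional k V] [CharZero k] [Finite G]
    (h : ∀ g ≠ 1, ρ.character g = 0) : Nat.card G ∣ finrank k V := by
  have := Fintype.ofFinite G
  have hG : (Nat.card G : k) ≠ 0 := Nat.cast_ne_zero.2 Nat.card_pos.ne'
  have := invertibleOfNonzero hG
  have hsum := card_inv_mul_sum_char_eq_finrank ρ
  rw [Fintype.sum_eq_single 1 h, char_one, inv_mul_eq_iff_eq_mul₀ hG] at hsum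
  exact ⟨_, by exact_mod_cast hsum⟩

lemma character_eq_zero_of_isConj [CharZero k] {s c : G} {n : ℕ} (hn : n ≠ 0) (hs : s ^ n = 1)
    (hc : ∀ i, IsConj c (c * s ^ i)) (hfix : ∀ v, ρ s v = v → v = 0) : ρ.character c = 0 := by
  have hzero : ∑ i ∈ Finset.range n, ρ (s ^ i) = 0 := by
    refine LinearMap.ext fun v => hfix _ ?_
    rw [LinearMap.sum_apply, map_sum]
    simp_rw [← End.mul_apply, ← map_mul, ← pow_succ']
    have := (Finset.sum_range_succ' (fun i => ρ (s ^ i) v) n).symm.trans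
      (Finset.sum_range_succ _ n)
    rwa [hs, pow_zero, add_left_inj] at this
  have hchar (i : ℕ) : LinearMap.trace k V (ρ (c * s ^ i)) = ρ.character c := by
    obtain ⟨g, hg⟩ := isConj_iff.1 (hc i)
    rw [← hg]
    exact ρ.char_conj c g
  have hsum : ∑ i ∈ Finset.range n, LinearMap.trace k V (ρ (c * s ^ i)) = 0 := by
    simp_rw [map_mul]
    rw [← map_sum, ← Finset.mul_sum, hzero, mul_zero, map_zero]
  simp_rw [hchar, Finset.sum_const, Finset.card_range, nsmul_eq_mul] at hsum
  exact (mul_eq_zero.1 hsum).resolve_left (Nat.cast_ne_zero.2 hn)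

lemma exists_fixed_eigenvector [FiniteDimensional k V] [IsAlgClosed k] {s f : G} {n : ℕ}
    (hsf : s * f = f * s ^ n) (hs : ∃ v, v ≠ 0 ∧ ρ s v = v) :
    ∃ v, v ≠ 0 ∧ ρ s v = v ∧ ∃ c : k, ρ f v = c • v := by
  let U := End.eigenspace (ρ s) 1
  have hU {v : V} : v ∈ U ↔ ρ s v = v := by rw [End.mem_eigenspace_iff, one_smul]
  have hf (v : V) (hv : v ∈ U) : ρ f v ∈ U := by
    have hpow : ρ (s ^ n) v = v := by
      rw [map_pow, End.coe_pow]
      exact Function.iterate_fixed (hU.1 hv) n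
    rw [hU, ← End.mul_apply, ← map_mul, hsf, map_mul, End.mul_apply, hpow]
  obtain ⟨v₀, hv₀, hsv₀⟩ := hs
  have : Nontrivial U := ⟨⟨⟨v₀, hU.2 hsv₀⟩, 0, fun h => hv₀ congr($h.1)⟩⟩
  obtain ⟨c, hc⟩ := End.exists_eigenvalue ((ρ f).restrict hf)
  obtain ⟨v, hv⟩ := hc.exists_hasEigenvector
  exact ⟨v, fun h => hv.2 (Subtype.ext h), hU.1 v.2, c, congr($(hv.apply_eq_smul).1)⟩

end Character

end WeightVector

namespace RegularMatroid

open Module Matrix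

section Representation

variable {α K V : Type*} [Field K] [AddCommGroup V] [Module K V] {M : Matroid α} {v : α → V}
  (hM : ∀ I ⊆ M.E, M.Indep I ↔ LinearIndepOn K v I)

include hM

lemma span_image_eq_of_isBase {B : Set α} (hB : M.IsBase B) :
    Submodule.span K (v '' B) = Submodule.span K (v '' M.E) := by
  refine le_antisymm (Submodule.span_mono (Set.image_mono hB.subset_ground))
    (Submodule.span_le.2 ?_)
  rintro _ ⟨e, he, rfl⟩
  by_contra hn
  have heB : e ∉ B := fun h => hn (Submodule.subset_span ⟨e, h, rfl⟩)
  have hBe := ((hM B hB.subset_ground).1 hB.indep).insert hn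
  exact (hB.insert_dep ⟨he, heB⟩).not_indep
    ((hM _ (Set.insert_subset he hB.subset_ground)).2 hBe)

lemma eRank_eq_finrank_span [FiniteDimensional K V] :
    M.eRank = finrank K (Submodule.span K (v '' M.E)) := by
  obtain ⟨B, hB⟩ := M.exists_isBase
  rw [← span_image_eq_of_isBase hM hB, ← hB.encard_eq_eRank,
    ← toENat_rank_span_set ((hM B hB.subset_ground).1 hB.indep), ← finrank_eq_rank,
    Cardinal.toENat_nat]

end Representation

lemma eRank_binaryMatroid {r : ℕ} (E : Set (Fin r → ZMod 2)) :
    (binaryMatroid E).eRank = finrank (ZMod 2) (Submodule.span (ZMod 2) E) := by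
  have hM (I) (hI : I ⊆ (binaryMatroid E).E) :
      (binaryMatroid E).Indep I ↔ LinearIndepOn (ZMod 2) id I := by
    exact (binaryMatroid_indep_iff E I).trans (and_iff_right hI)
  rw [eRank_eq_finrank_span hM, Set.image_id, binaryMatroid_ground]

lemma eRank_binaryMatroid_eq_iff {r : ℕ} {E : Set (Fin r → ZMod 2)} :
    (binaryMatroid E).eRank = r ↔ Submodule.span (ZMod 2) E = ⊤ := by
  rw [eRank_binaryMatroid, Nat.cast_inj, Submodule.eq_top_iff_finrank_eq, finrank_fin_fun]

lemma IsRegular.mono {r : ℕ} {E F : Set (Fin r → ZMod 2)} (hF : IsRegular (binaryMatroid F))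
    (h : E ⊆ F) : IsRegular (binaryMatroid E) := by
  obtain ⟨n, A, hA, hind⟩ := hF
  refine ⟨n, A, hA.submatrix id fun x : E => (⟨x.1, h x.2⟩ : F), fun I (hI : I ⊆ E) => ?_⟩
  rw [← hind I (hI.trans h), binaryMatroid_indep_iff, binaryMatroid_indep_iff, and_iff_right hI,
    and_iff_right (hI.trans h)]

section Determinant

lemma det_ne_zero_iff_linearIndependent {n K : Type*} [Fintype n] [DecidableEq n] [Field K]
    {v : n → n → K} : (of v).det ≠ 0 ↔ LinearIndependent K v := by
  rw [← isUnit_iff_ne_zero, ← isUnit_iff_isUnit_det, ← linearIndependent_rows_iff_isUnit]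
  rfl

variable {α K : Type*} [Field K] {r : ℕ}

lemma exists_det_ne_zero_of_linearIndepOn {v : α → Fin r → K} {E I : Set α}
    (hE : Submodule.span K (v '' E) = ⊤) (hI : I ⊆ E) (h : LinearIndepOn K v I) :
    ∃ b : Fin r → E, I ⊆ Set.range (fun i => (b i : α)) ∧ (of fun i => v (b i)).det ≠ 0 := by
  obtain ⟨B, hBE, hIB, hsp, hB⟩ := exists_linearIndepOn_extension h hI
  have hspan : ⊤ ≤ Submodule.span K (Set.range fun x : B => v x) := by
    rw [← hE, Submodule.span_le, ← Set.image_eq_range]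
    exact hsp
  let e : Fin r ≃ B := ((Pi.basisFun K (Fin r)).indexEquiv (Basis.mk hB hspan))
  refine ⟨fun i => ⟨e i, hBE (e i).2⟩, fun x hx => ⟨e.symm ⟨x, hIB hx⟩, by simp⟩, ?_⟩
  exact det_ne_zero_iff_linearIndependent.2 (hB.comp e e.injective)

lemma linearIndepOn_of_det_ne_zero {v : α → Fin r → K} {I : Set α} {b : Fin r → α}
    (hI : I ⊆ Set.range b) (h : (of fun i => v (b i)).det ≠ 0) : LinearIndepOn K v I := by
  have hvb : LinearIndependent K (v ∘ b) := det_ne_zero_iff_linearIndependent.1 h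
  exact ((linearIndepOn_range_iff hvb.injective.of_comp v).2 hvb).mono hI

end Determinant

section TotallyUnimodular

variable {α : Type*} {r : ℕ}

lemma isTotallyUnimodular_map_intCast {m n R : Type*} [CommRing R] {A : Matrix m n ℤ}
    (hA : A.IsTotallyUnimodular) : (A.map (Int.cast : ℤ → R)).IsTotallyUnimodular := by
  intro k f g hf hg
  obtain ⟨s, hs⟩ := hA k f g hf hg
  refine ⟨s, ?_⟩
  rw [submatrix_map, ← Int.cast_det, ← hs]
  cases s <;> simp

lemma intCast_ne_zero_iff_of_mem_range {K : Type*} [Field K] {d : ℤ}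
    (hd : d ∈ Set.range SignType.cast) : (d : K) ≠ 0 ↔ d ≠ 0 := by
  obtain ⟨s, rfl⟩ := hd
  cases s <;> simp

lemma linearIndepOn_of_isTotallyUnimodular {K L : Type} [Field K] [Field L]
    {A : Matrix (Fin r) α ℤ} {E I : Set α}
    (hA : (A.submatrix id (Subtype.val : E → α)).IsTotallyUnimodular)
    (hE : Submodule.span K ((A.map (Int.cast : ℤ → K)).col '' E) = ⊤) (hI : I ⊆ E)
    (h : LinearIndepOn K (A.map (Int.cast : ℤ → K)).col I) :
    LinearIndepOn L (A.map (Int.cast : ℤ → L)).col I := by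
  obtain ⟨b, hIb, hdet⟩ := exists_det_ne_zero_of_linearIndepOn hE hI h
  have hcast (F : Type) [Field F] :
      (of fun i => (A.map (Int.cast : ℤ → F)).col (b i)).det = ((A.submatrix id
        (Subtype.val : E → α)).submatrix id b).det := by
    rw [← det_transpose, Int.cast_det]
    rfl
  have hmem := (isTotallyUnimodular_iff _).1 hA r id b
  rw [hcast K, intCast_ne_zero_iff_of_mem_range hmem,
    ← intCast_ne_zero_iff_of_mem_range (K := L) hmem, ← hcast L] at hdet
  exact linearIndepOn_of_det_ne_zero hIb hdet

lemma isRegular_of_isTotallyUnimodular {E : Set (Fin r → ZMod 2)}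
    {A : Matrix (Fin r) (Fin r → ZMod 2) ℤ}
    (hA : (A.submatrix id (Subtype.val : E → Fin r → ZMod 2)).IsTotallyUnimodular)
    (hcast : A.map (Int.cast : ℤ → ZMod 2) = of fun i v => v i)
    (hE : ∀ j, Pi.single j 1 ∈ E) (hcol : ∀ j, A.col (Pi.single j 1) = Pi.single j 1) :
    IsRegular (binaryMatroid E) := by
  have hspan (K : Type) [Field K] :
      Submodule.span K ((A.map (Int.cast : ℤ → K)).col '' E) = ⊤ := by
    rw [← top_le_iff, ← (Pi.basisFun K (Fin r)).span_eq]
    refine Submodule.span_mono ?_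
    rintro _ ⟨j, rfl⟩
    refine ⟨_, hE j, funext fun i => ?_⟩
    have := congrArg (Int.cast : ℤ → K) (congrFun (hcol j) i)
    simpa [Pi.single_apply, Pi.basisFun_apply] using this
  refine ⟨r, A.map Int.cast, ?_, fun I (hI : I ⊆ E) => ?_⟩
  · exact isTotallyUnimodular_map_intCast hA
  · rw [binaryMatroid_indep_iff, and_iff_right hI]
    have hid : (A.map (Int.cast : ℤ → ZMod 2)).col = id := by rw [hcast]; rfl
    rw [← hid]
    exact ⟨linearIndepOn_of_isTotallyUnimodular hA (hspan _) hI,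
      linearIndepOn_of_isTotallyUnimodular hA (hspan _) hI⟩

end TotallyUnimodular

end RegularMatroid

namespace Fano

open Matrix Module RegularMatroid

/-- The seven points of the Fano plane, numbered along a Singer cycle: the lines are the triples
`{i, i + 1, i + 3}` modulo `7`. -/
def point : Fin 7 → Fin 3 → ZMod 2 :=
  ![![1, 0, 0], ![0, 1, 0], ![0, 0, 1], ![1, 1, 0], ![0, 1, 1], ![1, 1, 1], ![1, 0, 1]]

lemma point_injective : Function.Injective point := by decide

lemma point_ne_zero : ∀ i, point i ≠ 0 := by decide

lemma exists_point_eq : ∀ {v : Fin 3 → ZMod 2}, v ≠ 0 → ∃ i, point i = v := by decide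

/-- The complement, in the Fano plane, of the points with numbers in `S`. -/
def pointsOff (S : Finset (Fin 7)) : Set (Fin 3 → ZMod 2) := point '' (S : Set (Fin 7))ᶜ

lemma point_mem_pointsOff {S : Finset (Fin 7)} {i : Fin 7} : point i ∈ pointsOff S ↔ i ∉ S :=
  point_injective.mem_set_image

lemma pointsOff_subset_pointsOff {S T : Finset (Fin 7)} : pointsOff S ⊆ pointsOff T ↔ T ⊆ S :=
  (Set.image_subset_image_iff point_injective).trans Set.compl_subset_compl

lemma zero_notMem_pointsOff (S : Finset (Fin 7)) : 0 ∉ pointsOff S := by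
  rintro ⟨i, -, h⟩
  exact point_ne_zero i h

lemma exists_eq_pointsOff {E : Set (Fin 3 → ZMod 2)} (hE : 0 ∉ E) : ∃ S, pointsOff S = E := by
  classical
  refine ⟨({i | point i ∉ E} : Finset (Fin 7)), Set.ext fun v => ?_⟩
  by_cases hv : v = 0
  · simp only [hv, zero_notMem_pointsOff, hE]
  · obtain ⟨i, rfl⟩ := exists_point_eq hv
    simp only [point_mem_pointsOff, Finset.mem_filter_univ, not_not]

section Permutations

/-- The permutation of the points of the Fano plane induced by an element of `SL(3, 𝔽₂)`. -/
noncomputable def pointPerm : SpecialLinearGroup (Fin 3) (ZMod 2) →* Equiv.Perm (Fin 7) :=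
  MonoidHom.toHomPerm
    { toFun g i := Function.invFun point (g.toLin' (point i))
      map_one' := funext fun i => by
        rw [map_one]
        exact Function.leftInverse_invFun point_injective i
      map_mul' g h := funext fun i => by
        have hh : point (Function.invFun point (h.toLin' (point i))) = h.toLin' (point i) :=
          Function.invFun_eq (exists_point_eq ((map_ne_zero_iff _ h.toLin'.injective).2
            (point_ne_zero i)))
        rw [map_mul]
        exact congrArg (fun v => Function.invFun point (g.toLin' v)) hh.symm }

lemma point_pointPerm (g : SpecialLinearGroup (Fin 3) (ZMod 2)) (i : Fin 7) :
    point (pointPerm g i) = g.toLin' (point i) :=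
  Function.invFun_eq (exists_point_eq ((map_ne_zero_iff _ g.toLin'.injective).2 (point_ne_zero i)))

lemma pointPerm_eq_of_mulVec {g : SpecialLinearGroup (Fin 3) (ZMod 2)} {π : Equiv.Perm (Fin 7)}
    (h : ∀ i, (g : Matrix _ _ (ZMod 2)) *ᵥ point i = point (π i)) : pointPerm g = π :=
  Equiv.ext fun i => point_injective ((point_pointPerm g i).trans (h i))

lemma toLin'_image_pointsOff (g : SpecialLinearGroup (Fin 3) (ZMod 2)) (S : Finset (Fin 7)) :
    g.toLin' '' pointsOff S = pointsOff (S.map (pointPerm g).toEmbedding) := by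
  have hg : g.toLin' ∘ point = point ∘ pointPerm g := (funext (point_pointPerm g)).symm
  rw [pointsOff, pointsOff, ← Set.image_comp, hg, Set.image_comp, Set.image_compl_eq
    (pointPerm g).bijective, Finset.coe_map, Equiv.coe_toEmbedding]

end Permutations

section NonRepresentability

variable {K V : Type*} [Field K] [AddCommGroup V] [Module K V]

/- In the frame `x 0, x 1, x 2, x 5` the points `3, 4, 6` are `x 0 + x 1`, `x 1 + x 2` and
`x 0 + x 2` up to scaling, and these have determinant `2`. -/
lemma two_eq_zero_of_det_iff {x : Fin 7 → Fin 3 → K} (hframe : of (x ∘ ![0, 1, 2]) = 1)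
    (hx : ∀ t : Fin 3 → Fin 7, (of (x ∘ t)).det = 0 ↔ (of (point ∘ t)).det = 0) :
    (2 : K) = 0 := by
  have hbasis (i j) : x (![0, 1, 2] i) j = (1 : Matrix (Fin 3) (Fin 3) K) i j :=
    congrFun (congrFun hframe i) j
  have hzero (t) (h : (of (point ∘ t)).det = 0) := (det_fin_three _).symm.trans ((hx t).2 h)
  have hne (t) (h : (of (point ∘ t)).det ≠ 0) := (det_fin_three _).symm.trans_ne ((hx t).not.2 h)
  simp only [of_apply, Function.comp_apply] at hzero hne
  have h0 (j) : x 0 j = _ := hbasis 0 j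
  have h1 (j) : x 1 j = _ := hbasis 1 j
  have h2 (j) : x 2 j = _ := hbasis 2 j
  have h3 : x 3 2 = 0 := by simpa [h0, h1] using hzero ![0, 1, 3] (by decide)
  have h4 : x 4 0 = 0 := by simpa [h1, h2] using hzero ![1, 2, 4] (by decide)
  have h6 : x 6 1 = 0 := by simpa [h0, h2] using hzero ![0, 2, 6] (by decide)
  have h235 : x 3 0 * x 5 1 = x 3 1 * x 5 0 := by
    simpa [h2, sub_eq_zero] using hzero ![2, 3, 5] (by decide)
  have h045 : x 4 1 * x 5 2 = x 4 2 * x 5 1 := by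
    simpa [h0, sub_eq_zero] using hzero ![0, 4, 5] (by decide)
  have h165 : x 6 0 * x 5 2 = x 6 2 * x 5 0 := by
    simpa [h1, neg_add_eq_zero] using hzero ![1, 6, 5] (by decide)
  have h346 : x 3 0 * x 4 1 * x 6 2 + x 3 1 * x 4 2 * x 6 0 = 0 := by
    simpa [h3, h4, h6] using hzero ![3, 4, 6] (by decide)
  have h50 : x 5 0 ≠ 0 := by simpa [h1, h2] using hne ![1, 2, 5] (by decide)
  have h51 : x 5 1 ≠ 0 := by simpa [h0, h2] using hne ![0, 2, 5] (by decide)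
  have h52 : x 5 2 ≠ 0 := by simpa [h0, h1] using hne ![0, 1, 5] (by decide)
  have h31 : x 3 1 ≠ 0 := by simpa [h0, h2] using hne ![0, 2, 3] (by decide)
  have h42 : x 4 2 ≠ 0 := by simpa [h0, h1] using hne ![0, 1, 4] (by decide)
  have h60 : x 6 0 ≠ 0 := by simpa [h1, h2] using hne ![1, 2, 6] (by decide)
  have h : 2 * (x 3 1 * x 4 2 * x 6 0 * x 5 0 * x 5 1 * x 5 2) = 0 := by
    linear_combination x 5 0 * x 5 1 * x 5 2 * h346 - x 4 1 * x 5 2 * x 6 2 * x 5 0 * h235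
      - x 3 1 * x 5 0 * x 6 2 * x 5 0 * h045 + x 3 1 * x 5 0 * x 4 2 * x 5 1 * h165
  simpa [h31, h42, h60, h50, h51, h52] using h

lemma two_eq_zero_of_linearIndependent_iff (hV : finrank K V = 3) {x : Fin 7 → V}
    (hx : ∀ t : Fin 3 → Fin 7, LinearIndependent K (x ∘ t) ↔
      LinearIndependent (ZMod 2) (point ∘ t)) : (2 : K) = 0 := by
  have hframe : LinearIndependent K (x ∘ ![0, 1, 2]) := by
    rw [hx, ← det_ne_zero_iff_linearIndependent]
    decide
  let b := basisOfLinearIndependentOfCardEqFinrank hframe (by simp [hV])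
  refine two_eq_zero_of_det_iff (x := fun i => b.equivFun (x i)) ?_ fun t => ?_
  · ext i j
    have hb : b i = (x ∘ ![0, 1, 2]) i := by simp [b]
    rw [one_apply, ← b.equivFun_self, hb]
    rfl
  · rw [← not_iff_not, ← ne_eq, det_ne_zero_iff_linearIndependent, ← ne_eq,
      det_ne_zero_iff_linearIndependent, ← hx]
    exact b.equivFun.toLinearMap.linearIndependent_iff (LinearMap.ker_eq_bot.2 b.equivFun.injective)

end NonRepresentability

/-- The complement of the line `{i, i + 1, i + 3}`. -/
def lineCompl (i : Fin 7) : Finset (Fin 7) := {i + 2, i + 4, i + 5, i + 6}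

lemma linearIndependent_comp_of_linearIndepOn {ι α K L V W : Type*} [Field K] [Field L]
    [AddCommGroup V] [Module K V] [AddCommGroup W] [Module L W] {v : α → V} {w : α → W} {E : Set α}
    (h : ∀ I ⊆ E, LinearIndepOn K v I → LinearIndepOn L w I) {s : ι → α} (hs : ∀ i, s i ∈ E)
    (hv : LinearIndependent K (v ∘ s)) : LinearIndependent L (w ∘ s) := by
  have hinj : Function.Injective s := hv.injective.of_comp
  rw [← linearIndepOn_range_iff hinj] at hv ⊢
  exact h _ (Set.range_subset_iff.2 hs) hv

lemma span_ne_top_iff_exists_dotProduct {K n : Type*} [Field K] [Fintype n]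
    {E : Set (n → K)} : Submodule.span K E ≠ ⊤ ↔ ∃ w ≠ 0, ∀ v ∈ E, w ⬝ᵥ v = 0 := by
  classical
  rw [ne_eq, ← Submodule.dualAnnihilator_eq_bot_iff, ← ne_eq, Submodule.ne_bot_iff,
    (dotProductEquiv K n).surjective.exists]
  refine exists_congr fun w => ?_
  rw [and_comm, ← SetLike.mem_coe, Submodule.coe_dualAnnihilator_span, LinearEquiv.map_ne_zero_iff]
  rfl

lemma span_pointsOff_eq_top_iff {S : Finset (Fin 7)} :
    Submodule.span (ZMod 2) (pointsOff S) = ⊤ ↔ ∀ i, ¬lineCompl i ⊆ S := by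
  have hline : ∀ i, ∃ w ≠ 0, ∀ j, w ⬝ᵥ point j ≠ 0 ↔ j ∈ lineCompl i := by decide
  have hlines : ∀ w ≠ 0, ∃ i, ∀ j, w ⬝ᵥ point j ≠ 0 ↔ j ∈ lineCompl i := by decide
  have hmem (w i) (h : ∀ j, w ⬝ᵥ point j ≠ 0 ↔ j ∈ lineCompl i) :
      (∀ v ∈ pointsOff S, w ⬝ᵥ v = 0) ↔ lineCompl i ⊆ S := by
    simp only [pointsOff, Set.forall_mem_image, Finset.subset_iff, ← h]
    exact forall_congr' fun j => by rw [← not_imp_not, Set.notMem_compl_iff, Finset.mem_coe]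
  rw [← not_iff_not, not_forall_not, ← ne_eq, span_ne_top_iff_exists_dotProduct]
  constructor
  · rintro ⟨w, hw, h⟩
    obtain ⟨i, hi⟩ := hlines w hw
    exact ⟨i, (hmem w i hi).1 h⟩
  · rintro ⟨i, h⟩
    obtain ⟨w, hw, hi⟩ := hline i
    exact ⟨w, hw, (hmem w i hi).2 h⟩

lemma not_isRegular_pointsOff_empty : ¬IsRegular (binaryMatroid (pointsOff ∅)) := by
  rintro ⟨n, A, -, hA⟩
  have hspan : Submodule.span (ZMod 2) (pointsOff ∅) = ⊤ :=
    span_pointsOff_eq_top_iff.2 (by decide)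
  have hrank := (eRank_eq_finrank_span hA).symm.trans (eRank_binaryMatroid_eq_iff.2 hspan)
  have hI (I : Set (Fin 3 → ZMod 2)) (hI : I ⊆ pointsOff ∅) :
      LinearIndepOn ℝ A.col I ↔ LinearIndepOn (ZMod 2) id I :=
    (hA I hI).symm.trans (and_iff_right hI)
  let x (i : Fin 7) : Submodule.span ℝ (A.col '' pointsOff ∅) :=
    ⟨A.col (point i), Submodule.subset_span ⟨_, point_mem_pointsOff.2 (Finset.notMem_empty i), rfl⟩⟩
  have hx (t : Fin 3 → Fin 7) : LinearIndependent ℝ (x ∘ t) ↔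
      LinearIndependent (ZMod 2) (point ∘ t) := by
    have ht i : (point ∘ t) i ∈ pointsOff ∅ := point_mem_pointsOff.2 (Finset.notMem_empty _)
    rw [← LinearMap.linearIndependent_iff (Submodule.subtype _) (Submodule.ker_subtype _)]
    exact ⟨linearIndependent_comp_of_linearIndepOn (fun I h => (hI I h).1) ht,
      linearIndependent_comp_of_linearIndepOn (fun I h => (hI I h).2) ht⟩
  exact two_ne_zero (two_eq_zero_of_linearIndependent_iff (Nat.cast_inj.1 hrank) hx)

section Regularity

/-- The representation over `ℤ` of the graphic matroid of `K₄` by a vertex-edge incidence matrix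
with one row removed, indexed by the points of the Fano plane other than `(1, 1, 1)`. -/
def signedIncidence : Matrix (Fin 3) (Fin 3 → ZMod 2) ℤ :=
  of fun i v => ![((v 0).val : ℤ), (v 1).val * (1 - 2 * (v 0).val),
    (v 2).val * (1 - 2 * (v 0).val) * (1 - 2 * (v 1).val)] i

lemma signedIncidence_map_intCast :
    signedIncidence.map (Int.cast : ℤ → ZMod 2) = of fun i v => v i := by
  have h : ∀ i v, ((signedIncidence i v : ℤ) : ZMod 2) = v i := by decide
  exact ext h

lemma det_signedIncidence_mem_range {k : ℕ} {f : Fin k → Fin 3} (hf : Function.Injective f)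
    {t : Fin k → Fin 7} (ht : ∀ j, t j ≠ 5) :
    (signedIncidence.submatrix f (point ∘ t)).det ∈ Set.range SignType.cast := by
  have h1 : ∀ i a, ∃ s : SignType, s = signedIncidence i (point a) := by decide
  have h2 : ∀ i j a b, a ≠ 5 → b ≠ 5 → ∃ s : SignType, s =
      signedIncidence i (point a) * signedIncidence j (point b) -
        signedIncidence i (point b) * signedIncidence j (point a) := by decide
  have h3 : ∀ a b c, a ≠ 5 → b ≠ 5 → c ≠ 5 → ∃ s : SignType, s =
      (signedIncidence.submatrix id ![point a, point b, point c]).det := by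
    simp only [det_fin_three]
    decide
  have hk : k ≤ 3 := by simpa using Fintype.card_le_of_injective f hf
  interval_cases k
  · exact ⟨1, by simp⟩
  · simpa using h1 (f 0) (t 0)
  · rw [det_fin_two]
    exact h2 (f 0) (f 1) (t 0) (t 1) (ht 0) (ht 1)
  · obtain ⟨s, hs⟩ := h3 (t 0) (t 1) (t 2) (ht 0) (ht 1) (ht 2)
    let σ : Equiv.Perm (Fin 3) := .ofBijective f (Finite.injective_iff_bijective.1 hf)
    have hσ : signedIncidence.submatrix f (point ∘ t) =
        (signedIncidence.submatrix id ![point (t 0), point (t 1), point (t 2)]).submatrix σ id := by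
      ext i j
      fin_cases j <;> rfl
    rw [hσ, det_permute, ← hs]
    rcases Int.units_eq_one_or (Equiv.Perm.sign σ) with h | h <;> rw [h]
    · exact ⟨s, by simp⟩
    · exact ⟨-s, by simp⟩

lemma isRegular_pointsOff_five : IsRegular (binaryMatroid (pointsOff {5})) := by
  refine isRegular_of_isTotallyUnimodular (A := signedIncidence) ?_ signedIncidence_map_intCast
    (fun j => ?_) (by decide)
  · intro k f g hf _
    choose t ht hpt using fun j => (g j).2
    have hg : Subtype.val ∘ g = point ∘ t := (funext hpt).symm
    rw [submatrix_submatrix, hg, Function.id_comp]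
    exact det_signedIncidence_mem_range hf fun j => by simpa using ht j
  · have h : ∀ j : Fin 3, ∃ i, i ≠ 5 ∧ point i = Pi.single j 1 := by decide
    obtain ⟨i, hi, hj⟩ := h j
    exact hj ▸ point_mem_pointsOff.2 (by simpa using hi)

/-- A Singer cycle: an element of order `7`, which permutes the points of the Fano plane
cyclically. -/
def singer : SpecialLinearGroup (Fin 3) (ZMod 2) :=
  ⟨!![0, 0, 1; 1, 0, 1; 0, 1, 0], by decide⟩

lemma pointPerm_singer : pointPerm singer = Equiv.addRight 1 :=
  pointPerm_eq_of_mulVec (by decide)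

lemma pointPerm_singer_pow (k : Fin 7) : pointPerm (singer ^ k.val) = Equiv.addRight k := by
  rw [map_pow, pointPerm_singer]
  revert k
  decide

lemma isRegular_pointsOff_singleton (j : Fin 7) : IsRegular (binaryMatroid (pointsOff {j})) := by
  have hj : pointsOff {j} = (singer ^ (j - 5).val).toLin' '' pointsOff {5} := by
    rw [toLin'_image_pointsOff, Finset.map_singleton]
    simp only [Equiv.coe_toEmbedding, pointPerm_singer_pow, Equiv.coe_addRight, add_sub_cancel]
  rw [hj, binaryMatroid_image]
  exact isRegular_pointsOff_five.map _

end Regularity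

lemma isRegular_pointsOff_iff {S : Finset (Fin 7)} :
    IsRegular (binaryMatroid (pointsOff S)) ↔ S.Nonempty := by
  constructor
  · intro h
    rw [Finset.nonempty_iff_ne_empty]
    rintro rfl
    exact not_isRegular_pointsOff_empty h
  · rintro ⟨j, hj⟩
    exact (isRegular_pointsOff_singleton j).mono
      (pointsOff_subset_pointsOff.2 (Finset.singleton_subset_iff.2 hj))

/-- The independence complex of the dual of the Fano matroid: its faces are the nonempty sets of
points which contain no complement of a line. -/
def dualFanoComplex : PreAbstractSimplicialComplex (Fin 7) where
  faces := {S | S.Nonempty ∧ ∀ i, ¬lineCompl i ⊆ S}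
  isRelLowerSet_faces _ hS := ⟨hS.1, fun _ hTS hT => ⟨hT, fun i h => hS.2 i (h.trans hTS)⟩⟩

lemma mem_dualFanoComplex {S : Finset (Fin 7)} :
    S ∈ dualFanoComplex ↔ S.Nonempty ∧ ∀ i, ¬lineCompl i ⊆ S := Iff.rfl

set_option maxRecDepth 20000 in
lemma card_le_four_of_mem_dualFanoComplex : ∀ S ∈ dualFanoComplex, S.card ≤ 4 := by
  have h : ∀ S : Finset (Fin 7), (∀ i, ¬lineCompl i ⊆ S) → S.card ≤ 4 := by decide
  exact fun S hS => h S hS.2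

lemma pointsOff_mem_iff {S : Finset (Fin 7)} :
    (0 ∉ pointsOff S ∧ IsRegular (binaryMatroid (pointsOff S)) ∧
      (binaryMatroid (pointsOff S)).eRank = (3 : ℕ)) ↔ S ∈ dualFanoComplex := by
  rw [isRegular_pointsOff_iff, eRank_binaryMatroid_eq_iff, span_pointsOff_eq_top_iff,
    and_iff_right (zero_notMem_pointsOff S), mem_dualFanoComplex]

/-- The poset `IR(3, 𝔽₂)` is the opposite of the face poset of `dualFanoComplex`: a set of points
corresponds to its complement. -/
noncomputable def orderIsoFaces : IR 3 ≃o (↥dualFanoComplex)ᵒᵈ :=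
  (RelIso.ofSurjective (OrderEmbedding.ofMapLEIff
    (fun S : (↥dualFanoComplex)ᵒᵈ => (⟨pointsOff S.ofDual, pointsOff_mem_iff.2 S.ofDual.2⟩ : IR 3))
      fun _ _ => pointsOff_subset_pointsOff)
    fun ⟨E, hE⟩ => by
      obtain ⟨S, rfl⟩ := exists_eq_pointsOff hE.1
      exact ⟨.toDual ⟨S, pointsOff_mem_iff.1 hE⟩, rfl⟩).symm

lemma pointsOff_vertices (E : IR 3) : pointsOff (FacePoset.vertices orderIsoFaces E) = E.1 :=
  congrArg Subtype.val (orderIsoFaces.symm_apply_apply E)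

lemma vertices_smul (g : SpecialLinearGroup (Fin 3) (ZMod 2)) (E : IR 3) :
    FacePoset.vertices orderIsoFaces (g • E) =
      (FacePoset.vertices orderIsoFaces E).map (pointPerm g).toEmbedding := by
  have h : pointsOff (FacePoset.vertices orderIsoFaces (g • E)) =
      pointsOff ((FacePoset.vertices orderIsoFaces E).map (pointPerm g).toEmbedding) := by
    rw [pointsOff_vertices, ← toLin'_image_pointsOff, pointsOff_vertices]
    rfl
  exact (pointsOff_subset_pointsOff.1 h.ge).antisymm (pointsOff_subset_pointsOff.1 h.le)

end Fano

namespace Semiconjugation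

open scoped Pointwise

variable {G : Type*} [Group G] {s f : G} {n q : ℕ}

lemma pow_mul_eq_mul_pow (h : s * f = f * s ^ q) (m : ℕ) : s ^ m * f = f * s ^ (q * m) := by
  have hf : SemiconjBy f (s ^ q) s := h.symm
  rw [pow_mul]
  exact (hf.pow_right m).eq.symm

lemma isConj_mul_pow {r : ℕ} (hs : s ^ n = 1) (h : s * f = f * s ^ (q + 1))
    (hqr : q * r ≡ 1 [MOD n]) (i : ℕ) : IsConj f (f * s ^ i) := by
  refine isConj_iff.2 ⟨s ^ (r * i), mul_inv_eq_iff_eq_mul.2 ?_⟩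
  have hi : s ^ (q * (r * i)) = s ^ i := by
    rw [← mul_assoc]
    exact pow_eq_pow_iff_modEq.2
      (((hqr.mul_right i).of_dvd (orderOf_dvd_of_pow_eq_one hs)).trans (by rw [one_mul]))
  rw [pow_mul_eq_mul_pow h, add_one_mul, pow_add, hi, mul_assoc]

lemma card_closure_pair_le [Finite G] (h : f * s = s ^ q * f) :
    Nat.card (Subgroup.closure {s, f}) ≤ orderOf f * orderOf s := by
  have hnorm : Subgroup.zpowers f ≤ Subgroup.normalizer (Subgroup.zpowers s) := by
    refine Subgroup.zpowers_le.2 (Subgroup.mem_normalizer_fintype ?_)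
    rintro _ ⟨m, rfl⟩
    change f * s ^ m * f⁻¹ ∈ Subgroup.zpowers s
    rw [← conj_zpow, h, mul_inv_cancel_right]
    exact zpow_mem (pow_mem (Subgroup.mem_zpowers s) q) m
  have hclosure : (Subgroup.closure {s, f} : Set G) =
      (Subgroup.zpowers f : Set G) * (Subgroup.zpowers s : Set G) := by
    rw [← Subgroup.coe_mul_of_left_le_normalizer_right _ _ hnorm, Set.pair_comm, Set.insert_eq,
      Subgroup.closure_union, Subgroup.zpowers_eq_closure, Subgroup.zpowers_eq_closure]
  calc Nat.card (Subgroup.closure {s, f})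
      = Nat.card ((Subgroup.zpowers f : Set G) * (Subgroup.zpowers s : Set G) : Set G) :=
        congrArg (fun S : Set G => Nat.card S) hclosure
    _ ≤ Nat.card (Subgroup.zpowers f) * Nat.card (Subgroup.zpowers s) := Set.natCard_mul_le
    _ = orderOf f * orderOf s := by rw [Nat.card_zpowers, Nat.card_zpowers]

end Semiconjugation

namespace Fano

open Matrix Semiconjugation WeightVector

/-- An element of order `3` of `SL(3, 𝔽₂)` which normalizes the Singer cycle: it doubles the
numbers of the points. -/
def frob : SpecialLinearGroup (Fin 3) (ZMod 2) :=
  ⟨!![1, 0, 0; 0, 0, 1; 0, 1, 1], by decide⟩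

/-- An involution in `SL(3, 𝔽₂)` which inverts `frob`. -/
def invol : SpecialLinearGroup (Fin 3) (ZMod 2) :=
  ⟨!![1, 0, 0; 0, 0, 1; 0, 1, 0], by decide⟩

/-- The normalizer of the Singer cycle, a Frobenius group of order `21`. -/
abbrev singerNormalizer : Subgroup (SpecialLinearGroup (Fin 3) (ZMod 2)) :=
  Subgroup.closure {singer, frob}

lemma singer_mem : singer ∈ singerNormalizer :=
  Subgroup.subset_closure (Set.mem_insert _ _)

lemma frob_mem : frob ∈ singerNormalizer :=
  Subgroup.subset_closure (Set.mem_insert_of_mem _ rfl)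

lemma singer_pow_seven : singer ^ 7 = 1 := by decide

lemma frob_pow_three : frob ^ 3 = 1 := by decide

lemma frob_mul_singer : frob * singer = singer ^ 2 * frob := by decide

lemma singer_mul_frob : singer * frob = frob * singer ^ 4 := by decide

lemma frob_mul_invol : frob * invol = invol * frob⁻¹ := by decide

lemma pointPerm_frob (i : Fin 7) : pointPerm frob i = 2 * i :=
  point_injective ((point_pointPerm frob i).trans (by revert i; decide))

lemma pointPerm_invol : pointPerm invol = Equiv.swap 1 2 * Equiv.swap 3 6 :=
  pointPerm_eq_of_mulVec (by decide)

lemma card_specialLinearGroup : Nat.card (SpecialLinearGroup (Fin 3) (ZMod 2)) = 168 := by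
  have hdet (g : GL (Fin 3) (ZMod 2)) : g.1.det = 1 :=
    Fin.eq_one_of_ne_zero _ (GeneralLinearGroup.det_ne_zero g)
  have hbij : Function.Bijective
      (SpecialLinearGroup.toGL : SpecialLinearGroup (Fin 3) (ZMod 2) →* GL (Fin 3) (ZMod 2)) :=
    ⟨SpecialLinearGroup.toGL_injective, fun g => ⟨⟨g.1, hdet g⟩, Units.ext rfl⟩⟩
  rw [Nat.card_congr (Equiv.ofBijective _ hbij), card_GL_field, ZMod.card]
  decide

lemma orderOf_singer : orderOf singer = 7 :=
  have := Fact.mk Nat.prime_seven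
  orderOf_eq_prime singer_pow_seven (by decide)

lemma orderOf_frob : orderOf frob = 3 := orderOf_eq_prime frob_pow_three (by decide)

lemma card_singerNormalizer : Nat.card singerNormalizer = 21 := by
  refine le_antisymm ?_ (Nat.le_of_dvd Nat.card_pos
    (Nat.Coprime.mul_dvd_of_dvd_of_dvd (m := 7) (n := 3) (by decide) ?_ ?_))
  · simpa only [orderOf_singer, orderOf_frob] using card_closure_pair_le frob_mul_singer
  · exact orderOf_singer.symm.dvd.trans (singerNormalizer.orderOf_dvd_natCard singer_mem)
  · exact orderOf_frob.symm.dvd.trans (singerNormalizer.orderOf_dvd_natCard frob_mem)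

lemma index_singerNormalizer : singerNormalizer.index = 8 := by
  have h := singerNormalizer.card_mul_index
  rw [card_singerNormalizer, card_specialLinearGroup] at h
  lia

section DoubleCosets

lemma eq_of_pointPerm_eq {g h : SpecialLinearGroup (Fin 3) (ZMod 2)}
    (h₀ : pointPerm g 0 = pointPerm h 0) (h₁ : pointPerm g 1 = pointPerm h 1)
    (h₂ : pointPerm g 2 = pointPerm h 2) : g = h := by
  have hpoint {i : Fin 7} (hi : pointPerm g i = pointPerm h i) :
      g.toLin' (point i) = h.toLin' (point i) := by
    rw [← point_pointPerm, ← point_pointPerm, hi]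
  have hbasis (j : Fin 3) : g.toLin' (Pi.single j 1) = h.toLin' (Pi.single j 1) := by
    have hj : ∀ j : Fin 3, Pi.single j 1 = point (j.castLE (by decide)) := by decide
    rw [hj]
    fin_cases j
    exacts [hpoint h₀, hpoint h₁, hpoint h₂]
  exact SpecialLinearGroup.toLin'_injective (LinearEquiv.toLinearMap_injective
    ((Pi.basisFun (ZMod 2) (Fin 3)).ext fun j => by simpa using hbasis j))

/-- The condition on three numbers to be of the form `a, a + u, a + 2 * u` with `u` a nonzero square
modulo `7`, as are the images of `0, 1, 2` under the normalizer of the Singer cycle. -/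
abbrev IsProgression (a b c : Fin 7) : Prop :=
  b - a ∈ ({1, 2, 4} : Finset (Fin 7)) ∧ c - a = 2 * (b - a)

lemma mem_singerNormalizer_of_isProgression {g : SpecialLinearGroup (Fin 3) (ZMod 2)}
    (hg : IsProgression (pointPerm g 0) (pointPerm g 1) (pointPerm g 2)) :
    g ∈ singerNormalizer := by
  have hfrob (u : Fin 7) (hu : u ∈ ({1, 2, 4} : Finset (Fin 7))) :
      ∃ n, ∀ i, pointPerm (frob ^ n) i = u * i := by
    have hu : ∃ n : Fin 3, ∀ i, (2 * ·)^[n.val] i = u * i := by revert u; decide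
    obtain ⟨n, hn⟩ := hu
    refine ⟨n, fun i => ?_⟩
    rw [← hn, map_pow, Equiv.Perm.coe_pow]
    exact congrArg (fun f => f^[n.val] i) (funext pointPerm_frob)
  obtain ⟨n, hn⟩ := hfrob _ hg.1
  suffices g = singer ^ (pointPerm g 0).val * frob ^ n from
    this ▸ mul_mem (pow_mem singer_mem _) (pow_mem frob_mem n)
  have hperm (i : Fin 7) : pointPerm (singer ^ (pointPerm g 0).val * frob ^ n) i =
      (pointPerm g 1 - pointPerm g 0) * i + pointPerm g 0 := by
    rw [map_mul, Equiv.Perm.mul_apply, hn, pointPerm_singer_pow]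
    rfl
  refine eq_of_pointPerm_eq ?_ ?_ ?_ <;> rw [hperm]
  · rw [mul_zero, zero_add]
  · rw [mul_one, sub_add_cancel]
  · rw [mul_comm, ← hg.2, sub_add_cancel]

lemma isProgression_or_exists : ∀ a b c : Fin 7, a ≠ b → a ≠ c → b ≠ c →
    point a + point b + point c ≠ 0 → IsProgression a b c ∨
      ∃ j, ∀ π : Equiv.Perm (Fin 7), π = Equiv.swap 1 2 * Equiv.swap 3 6 →
        IsProgression (π (a + j)) (π (b + j)) (π (c + j)) := by
  simp only [forall_eq]
  decide

lemma exists_eq_mul_invol_mul {g : SpecialLinearGroup (Fin 3) (ZMod 2)}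
    (hg : g ∉ singerNormalizer) :
    ∃ a ∈ singerNormalizer, ∃ b ∈ singerNormalizer, g = a * invol * b := by
  have hne {i j : Fin 7} (h : i ≠ j) : pointPerm g i ≠ pointPerm g j := (pointPerm g).injective.ne h
  have hspan : point (pointPerm g 0) + point (pointPerm g 1) + point (pointPerm g 2) ≠ 0 := by
    simp only [point_pointPerm, ← map_add, ne_eq, LinearEquiv.map_eq_zero_iff]
    decide
  obtain ⟨j, hj⟩ := (isProgression_or_exists _ _ _ (hne (by decide)) (hne (by decide))
    (hne (by decide)) hspan).resolve_left (mt mem_singerNormalizer_of_isProgression hg)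
  have hperm (i : Fin 7) : pointPerm (invol * singer ^ j.val * g) i =
      pointPerm invol (pointPerm g i + j) := by
    rw [map_mul, map_mul, pointPerm_singer_pow]
    rfl
  refine ⟨(singer ^ j.val)⁻¹, inv_mem (pow_mem singer_mem _), invol * singer ^ j.val * g,
    mem_singerNormalizer_of_isProgression ?_, ?_⟩
  · simp only [hperm]
    exact hj _ pointPerm_invol
  · have hinvol : invol * invol = 1 := by decide
    simp only [mul_assoc]
    rw [← mul_assoc invol invol, hinvol, one_mul, inv_mul_cancel_left]

end DoubleCosets

/-- Since `invol` inverts `frob`, a character of the normalizer which agrees with its conjugate by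
`invol` is trivial on `frob` squared. -/
lemma satisfiesMackey {k : Type*} [Field k] {χ : singerNormalizer →* kˣ}
    (hχ : χ ⟨frob, frob_mem⟩ ≠ 1) : SatisfiesMackey χ := by
  intro g hg
  obtain ⟨a, ha, b, hb, rfl⟩ := exists_eq_mul_invol_mul hg
  let f : singerNormalizer := ⟨frob, frob_mem⟩
  refine ⟨⟨a, ha⟩ * f * ⟨a, ha⟩⁻¹, ⟨b, hb⟩⁻¹ * f⁻¹ * ⟨b, hb⟩, ?_, fun h => hχ ?_⟩
  · change a * frob * a⁻¹ * (a * invol * b) = a * invol * b * (b⁻¹ * frob⁻¹ * b)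
    simp only [mul_assoc, inv_mul_cancel_left, mul_inv_cancel_left]
    rw [← mul_assoc frob, frob_mul_invol, mul_assoc]
  · have hf : χ f ^ 3 = 1 := by
      rw [← map_pow, show f ^ 3 = 1 from Subtype.ext frob_pow_three, map_one]
    simp only [map_mul, map_inv, mul_inv_cancel_comm, inv_mul_cancel_comm] at h
    rw [pow_succ, sq, eq_inv_iff_mul_eq_one.1 h, one_mul] at hf
    exact hf

end Fano

namespace Fano

open FacePoset Finset

section Coordinates

/-- Eight tuples of points whose values coordinatize the cycles of the dual Fano complex. -/
def coordTuple : Fin 8 → Fin 4 → Fin 7 :=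
  ![![0, 1, 2, 3], ![1, 2, 3, 4], ![3, 0, 4, 1], ![0, 4, 1, 5], ![1, 3, 5, 0], ![3, 5, 0, 2],
    ![5, 0, 2, 4], ![2, 3, 4, 5]]

/-- The sets of four points that underlie one of the tuples `coordTuple i` or are not faces of the
dual Fano complex. -/
def IsCoordSet (S : Finset (Fin 7)) : Prop :=
  (∃ i, univ.image (coordTuple i) = S) ∨ ∃ i, lineCompl i = S
deriving Decidable

set_option maxRecDepth 20000 in
lemma isCoordSet_or_exists_exchange : ∀ S : Finset (Fin 7), #S = 4 → 6 ∉ S →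
    IsCoordSet S ∨ ∃ x ∈ S, ∀ y ∉ S, IsCoordSet (insert y (S.erase x)) := by
  decide

variable {k : Type} [CommRing k] {F : (Fin 4 → Fin 7) → k}

lemma vanishesOn_of_isCoordSet (hF : F ∈ alternatingCycles k 2 dualFanoComplex)
    (h : ∀ i, F (coordTuple i) = 0) {S : Finset (Fin 7)} (hS : IsCoordSet S) : VanishesOn F S := by
  obtain ⟨i, rfl⟩ | ⟨i, rfl⟩ := hS
  · exact vanishesOn_image hF (h i)
  · exact vanishesOn_of_notMem hF fun hi => (mem_dualFanoComplex.1 hi).2 i subset_rfl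

lemma eq_zero_of_coordTuple (hF : F ∈ alternatingCycles k 2 dualFanoComplex)
    (h : ∀ i, F (coordTuple i) = 0) : F = 0 := by
  have hoff : ∀ S : Finset (Fin 7), #S = 4 → 6 ∉ S → VanishesOn F S := fun S hS h6 => by
    obtain hcoord | ⟨x, hx, hexch⟩ := isCoordSet_or_exists_exchange S hS h6
    · exact vanishesOn_of_isCoordSet hF h hcoord
    · exact vanishesOn_of_exchange hF hx fun y hy => vanishesOn_of_isCoordSet hF h (hexch y hy)
  funext d
  by_cases hd : Function.Injective d
  · have hcard : #(univ.image d) = 4 := by rw [card_image_of_injective _ hd, card_fin]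
    by_cases h6 : 6 ∈ univ.image d
    · refine vanishesOn_of_exchange hF h6 (fun y hy => hoff _ ?_ ?_) d rfl
      · rw [card_insert_of_notMem fun h => hy (mem_of_mem_erase h), card_erase_of_mem h6, hcard]
      · rw [mem_insert, not_or]
        exact ⟨fun h => hy (h ▸ h6), notMem_erase _ _⟩
    · exact hoff _ hcard h6 d rfl
  · exact apply_eq_zero_of_not_injective hF hd

/-- The values of a cycle on the tuples `coordTuple i`. -/
def coord (k : Type) [CommRing k] :
    alternatingCycles k 2 dualFanoComplex →ₗ[k] Fin 8 → k :=
  LinearMap.funLeft k k coordTuple ∘ₗ Submodule.subtype _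

lemma coord_injective (k : Type) [CommRing k] : Function.Injective (coord k) :=
  (injective_iff_map_eq_zero _).2 fun F hF =>
    Subtype.ext (eq_zero_of_coordTuple F.2 (congr_fun hF))

end Coordinates

section Eigencycle

/-- The skew-symmetric circulant form on `ℤ/7` with `ε(a, a + k) = 1`. -/
def circ (k a b : Fin 7) : ℤ := (if b = a + k then 1 else 0) - (if a = b + k then 1 else 0)

lemma circ_swap (k a b : Fin 7) : circ k b a = -circ k a b :=
  (neg_sub _ _).symm

lemma sum_circ : ∀ k b : Fin 7, ∑ a, circ k a b = 0 := by decide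

lemma circ_add_one : ∀ k a b : Fin 7, circ k (a + 1) (b + 1) = circ k a b := by decide

lemma circ_two_mul : ∀ k a b : Fin 7, circ (2 * k) (2 * a) (2 * b) = circ k a b := by decide

lemma pfaffian_circ_lineCompl : ∀ k i : Fin 7,
    pfaffian (circ k) ![i + 2, i + 4, i + 5, i + 6] = 0 := by decide

lemma lineCompl_eq_image (i : Fin 7) : lineCompl i = univ.image ![i + 2, i + 4, i + 5, i + 6] := by
  decide +revert

lemma card_lineCompl (i : Fin 7) : #(lineCompl i) = 4 := by
  decide +revert

lemma pfaffian_circ_mem_alternatingCycles (k : Fin 7) :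
    pfaffian (circ k) ∈ alternatingCycles ℤ 2 dualFanoComplex := by
  refine mem_alternatingCycles_of_swap (fun S hS hcard => ?_) (pfaffian_comp_swap (circ_swap k))
    (sum_pfaffian_update (sum_circ k))
  have hne : S.Nonempty := card_pos.1 (by omega)
  obtain ⟨i, hi⟩ : ∃ i, lineCompl i ⊆ S := by
    by_contra! h
    exact hS (mem_dualFanoComplex.2 ⟨hne, h⟩)
  refine ⟨_, ?_, pfaffian_circ_lineCompl k i⟩
  rw [← lineCompl_eq_image]
  exact eq_of_subset_of_card_le hi (by rw [hcard, card_lineCompl])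

/-- The combination of Pfaffians of circulant forms that is invariant under translation and an
eigenvector of doubling, the latter permuting the three forms cyclically. -/
def eigencycle (ω : ℂ) (d : Fin 4 → Fin 7) : ℂ :=
  pfaffian (circ 1) d + ω ^ 2 * pfaffian (circ 2) d + ω * pfaffian (circ 4) d

lemma eigencycle_mem_alternatingCycles (ω : ℂ) :
    eigencycle ω ∈ alternatingCycles ℂ 2 dualFanoComplex := by
  have hmem (k : Fin 7) := intCast_mem_alternatingCycles (k := ℂ)
    (pfaffian_circ_mem_alternatingCycles k)
  exact add_mem (add_mem (hmem 1) (Submodule.smul_mem _ (ω ^ 2) (hmem 2)))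
    (Submodule.smul_mem _ ω (hmem 4))

lemma eigencycle_add_one (ω : ℂ) (d : Fin 4 → Fin 7) :
    eigencycle ω (fun i => d i + 1) = eigencycle ω d := by
  simp only [eigencycle, pfaffian, circ_add_one]

lemma pfaffian_circ_two_mul (k : Fin 7) (d : Fin 4 → Fin 7) :
    pfaffian (circ (2 * k)) (fun i => 2 * d i) = pfaffian (circ k) d := by
  simp only [pfaffian, circ_two_mul]

lemma eigencycle_two_mul {ω : ℂ} (hω : ω ^ 3 = 1) (d : Fin 4 → Fin 7) :
    ω * eigencycle ω (fun i => 2 * d i) = eigencycle ω d := by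
  have h1 := pfaffian_circ_two_mul 1 d
  have h2 := pfaffian_circ_two_mul 2 d
  have h4 := pfaffian_circ_two_mul 4 d
  rw [show (2 * 1 : Fin 7) = 2 from rfl] at h1
  rw [show (2 * 2 : Fin 7) = 4 from rfl] at h2
  rw [show (2 * 4 : Fin 7) = 1 from rfl] at h4
  simp only [eigencycle, h1, h2, h4]
  linear_combination ((pfaffian (circ 1) d : ℤ) : ℂ) * hω

lemma eigencycle_ne_zero {ω : ℂ} (hω : ω ^ 3 = 1) (hω1 : ω ≠ 1) : eigencycle ω ≠ 0 := by
  intro h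
  have h1 : pfaffian (circ 1) ![0, 1, 2, 3] = 1 := by decide
  have h2 : pfaffian (circ 2) ![0, 1, 2, 3] = -1 := by decide
  have h4 : pfaffian (circ 4) ![0, 1, 2, 3] = 0 := by decide
  have hval : 1 - ω ^ 2 = 0 := by
    simpa [eigencycle, h1, h2, h4, ← sub_eq_add_neg] using congr_fun h ![0, 1, 2, 3]
  exact hω1 (by linear_combination hω + ω * hval)

end Eigencycle

end Fano

namespace Fano

open Semiconjugation WeightVector Module

variable {V : Type*} [AddCommGroup V] [Module ℂ V]
  {σ : Representation ℂ (Matrix.SpecialLinearGroup (Fin 3) (ZMod 2)) V}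

lemma card_singerNormalizer_ne_zero : (Nat.card singerNormalizer : ℂ) ≠ 0 :=
  Nat.cast_ne_zero.2 Nat.card_pos.ne'

lemma isWeightVector_of_singer_frob {χ : singerNormalizer →* ℂˣ} {v : V}
    (hs : σ singer v = (χ ⟨singer, singer_mem⟩ : ℂ) • v)
    (hf : σ frob v = (χ ⟨frob, frob_mem⟩ : ℂ) • v) : IsWeightVector σ χ v :=
  isWeightVector_of_generators fun _ hg => by
    obtain rfl | rfl := hg
    exacts [hs, hf]

lemma exists_isWeightVector_of_eigenvector {v : V} (hv : v ≠ 0) (hs : σ singer v = v) {c : ℂ}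
    (hf : σ frob v = c • v) : ∃ χ : singerNormalizer →* ℂˣ, IsWeightVector σ χ v ∧
      χ ⟨singer, singer_mem⟩ = 1 ∧ (χ ⟨frob, frob_mem⟩ : ℂ) = c := by
  obtain ⟨χ, hχ⟩ := exists_isWeightVector (ρ := σ) (S := {singer, frob}) hv (by
    rintro s (rfl | rfl)
    exacts [⟨1, by rw [hs, one_smul]⟩, ⟨c, hf⟩])
  have hχs := (hχ ⟨singer, singer_mem⟩).symm.trans (hs.trans (one_smul ℂ v).symm)
  have hχf := (hχ ⟨frob, frob_mem⟩).symm.trans hf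
  exact ⟨χ, hχ, Units.ext (smul_left_injective ℂ hv hχs), smul_left_injective ℂ hv hχf⟩

lemma singer_mul_frob_sq : singer * frob ^ 2 = frob ^ 2 * singer ^ 2 := by decide

lemma exists_singer_fixed (hV : ¬3 ∣ finrank ℂ V) [FiniteDimensional ℂ V] :
    ∃ v, v ≠ 0 ∧ σ singer v = v := by
  by_contra! h
  have hfix (v : V) (hv : σ singer v = v) : v = 0 := by
    by_contra h0
    exact h v h0 hv
  have hchar {g : Matrix.SpecialLinearGroup (Fin 3) (ZMod 2)}
      (hg : ∀ i, IsConj g (g * singer ^ i)) : σ.character g = 0 :=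
    character_eq_zero_of_isConj (by norm_num) singer_pow_seven hg hfix
  have h1 : σ.character frob = 0 :=
    hchar (isConj_mul_pow (r := 5) singer_pow_seven singer_mul_frob (by decide))
  have h2 : σ.character (frob ^ 2) = 0 :=
    hchar (isConj_mul_pow (r := 1) singer_pow_seven singer_mul_frob_sq (by decide))
  have hdvd := card_dvd_finrank (ρ := σ.comp (Subgroup.zpowers frob).subtype) (by
    rintro ⟨g, hg⟩ hne
    obtain ⟨n, hn, rfl⟩ := Finset.mem_image.1 (mem_zpowers_iff_mem_range_orderOf.1 hg)
    change σ.character (frob ^ n) = 0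
    rw [Finset.mem_range, orderOf_frob] at hn
    interval_cases n
    · exact absurd (Subtype.ext (pow_zero frob)) hne
    · rwa [pow_one]
    · exact h2)
  rw [Nat.card_zpowers, orderOf_frob] at hdvd
  exact hV hdvd

lemma exists_isWeightVector_of_finrank_eq_eight (hσ : σ.IsIrreducible) (hV : finrank ℂ V = 8) :
    ∃ χ : singerNormalizer →* ℂˣ, χ ⟨singer, singer_mem⟩ = 1 ∧ χ ⟨frob, frob_mem⟩ ≠ 1 ∧
      ∃ v, v ≠ 0 ∧ IsWeightVector σ χ v := by
  have : FiniteDimensional ℂ V := finite_of_finrank_pos (by omega)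
  obtain ⟨v, hv0, hvs, c, hvf⟩ := exists_fixed_eigenvector singer_mul_frob
    (exists_singer_fixed (σ := σ) (by omega))
  obtain ⟨χ, hv, hs, rfl⟩ := exists_isWeightVector_of_eigenvector hv0 hvs hvf
  refine ⟨χ, hs, fun hf => ?_, v, hv0, hv⟩
  have hfixed : IsWeightVector σ (1 : singerNormalizer →* ℂˣ) v :=
    isWeightVector_of_singer_frob (by simpa using hvs) (by simpa [hf] using hvf)
  have hlt := finrank_lt_index hσ (by omega) hv0 hfixed
  rw [hV, index_singerNormalizer] at hlt
  exact hlt.false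

end Fano

namespace RegularMatroid

open FacePoset Fano WeightVector Module

/-- The third homology of `IR(3, 𝔽₂)` as the space of top-dimensional cycles of the dual Fano
complex. -/
noncomputable def cycleEquiv : homologyIR 3 3 ≃ₗ[ℂ] alternatingCycles ℂ 2 dualFanoComplex :=
  homologyEquiv ℂ orderIsoFaces card_le_four_of_mem_dualFanoComplex

lemma cycleEquiv_homologyRep (g : Matrix.SpecialLinearGroup (Fin 3) (ZMod 2)) (z : homologyIR 3 3)
    (d : Fin 4 → Fin 7) :
    (cycleEquiv (homologyRep 3 3 g z)).1 (pointPerm g ∘ d) = (cycleEquiv z).1 d :=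
  homologyEquiv_homologyMap orderIsoFaces card_le_four_of_mem_dualFanoComplex
    ((MulAction.toPerm g).toOrderIso (smul_mono g) (smul_mono g⁻¹)) (vertices_smul g) z d

lemma homologyRep_apply_eq_smul {g : Matrix.SpecialLinearGroup (Fin 3) (ZMod 2)} {c : ℂ}
    {z : homologyIR 3 3}
    (h : ∀ d, c * (cycleEquiv z).1 (pointPerm g ∘ d) = (cycleEquiv z).1 d) :
    homologyRep 3 3 g z = c • z := by
  refine cycleEquiv.injective (Subtype.ext (funext fun d => ?_))
  obtain ⟨e, rfl⟩ : ∃ e, pointPerm g ∘ e = d :=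
    ⟨(pointPerm g).symm ∘ d, by rw [← Function.comp_assoc, Equiv.self_comp_symm, Function.id_comp]⟩
  rw [cycleEquiv_homologyRep, map_smul]
  exact (h e).symm

lemma exists_homologyRep_eigenvector {ζ : ℂ} (hζ : ζ ^ 3 = 1) (hζ1 : ζ ≠ 1) :
    ∃ z : homologyIR 3 3, z ≠ 0 ∧ homologyRep 3 3 singer z = z ∧
      homologyRep 3 3 frob z = ζ • z := by
  obtain ⟨z, hz⟩ := cycleEquiv.surjective ⟨_, eigencycle_mem_alternatingCycles ζ⟩
  refine ⟨z, ?_, ?_, ?_⟩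
  · rintro rfl
    rw [map_zero] at hz
    exact eigencycle_ne_zero hζ hζ1 (congr_arg Subtype.val hz).symm
  · rw [homologyRep_apply_eq_smul (c := 1) fun d => ?_, one_smul]
    rw [hz, pointPerm_singer, one_mul]
    exact eigencycle_add_one ζ d
  · refine homologyRep_apply_eq_smul fun d => ?_
    rw [hz, show pointPerm frob ∘ d = fun i => 2 * d i from funext fun i => pointPerm_frob (d i)]
    exact eigencycle_two_mul hζ d

lemma exists_homologyRep_isWeightVector {χ : singerNormalizer →* ℂˣ}
    (hs : χ ⟨singer, singer_mem⟩ = 1) (hf : χ ⟨frob, frob_mem⟩ ≠ 1) :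
    ∃ z, z ≠ 0 ∧ IsWeightVector (homologyRep 3 3) χ z := by
  have hf3 : (χ ⟨frob, frob_mem⟩ : ℂ) ^ 3 = 1 := by
    have hpow : (⟨frob, frob_mem⟩ : singerNormalizer) ^ 3 = 1 := Subtype.ext frob_pow_three
    rw [← Units.val_pow_eq_pow_val, ← map_pow, hpow, map_one, Units.val_one]
  obtain ⟨z, hz0, hzs, hzf⟩ := exists_homologyRep_eigenvector hf3 fun h => hf (Units.ext h)
  exact ⟨z, hz0, isWeightVector_of_singer_frob (by rw [hs, hzs, Units.val_one, one_smul]) hzf⟩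

lemma exists_satisfiesMackey_isWeightVector : ∃ χ : singerNormalizer →* ℂˣ,
    SatisfiesMackey χ ∧ ∃ z, z ≠ 0 ∧ IsWeightVector (homologyRep 3 3) χ z := by
  obtain ⟨ζ, hζ⟩ := HasEnoughRootsOfUnity.exists_primitiveRoot ℂ 3
  have hζ1 := hζ.ne_one (by norm_num)
  obtain ⟨z, hz0, hzs, hzf⟩ := exists_homologyRep_eigenvector hζ.pow_eq_one hζ1
  obtain ⟨χ, hχ, -, hf⟩ := exists_isWeightVector_of_eigenvector hz0 hzs hzf
  exact ⟨χ, satisfiesMackey fun h => hζ1 (by rw [← hf, h, Units.val_one]), z, hz0, hχ⟩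

lemma finrank_homologyIR : finrank ℂ (homologyIR 3 3) = 8 := by
  have hinj := (coord_injective ℂ).comp cycleEquiv.injective
  let f := coord ℂ ∘ₗ cycleEquiv.toLinearMap
  have : FiniteDimensional ℂ (homologyIR 3 3) := Module.Finite.of_injective f hinj
  obtain ⟨χ, hχ, z, hz0, hz⟩ := exists_satisfiesMackey_isWeightVector
  refine le_antisymm ?_ ?_
  · simpa using LinearMap.finrank_le_finrank_of_injective (f := f) hinj
  · rw [← index_singerNormalizer]
    exact index_le_finrank card_singerNormalizer_ne_zero hχ hz hz0

lemma isIrreducible_homologyRep : (homologyRep 3 3).IsIrreducible := by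
  obtain ⟨χ, hχ, z, hz0, hz⟩ := exists_satisfiesMackey_isWeightVector
  exact isIrreducible_of_finrank_eq card_singerNormalizer_ne_zero hχ hz hz0
    (finrank_homologyIR.trans index_singerNormalizer.symm)

end RegularMatroid

theorem mainTheorem4 :
    (RegularMatroid.homologyRep 3 3).IsIrreducible ∧
    Module.finrank ℂ (RegularMatroid.homologyIR 3 3) = 8 ∧
    ∀ (V : Type*) [AddCommGroup V] [Module ℂ V]
      (σ : Representation ℂ (Matrix.SpecialLinearGroup (Fin 3) (ZMod 2)) V),
      σ.IsIrreducible → Module.finrank ℂ V = 8 →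
        Nonempty (σ.Equiv (RegularMatroid.homologyRep 3 3)) := by
  refine ⟨RegularMatroid.isIrreducible_homologyRep, RegularMatroid.finrank_homologyIR,
    fun V _ _ σ hσ hV => ?_⟩
  obtain ⟨χ, hs, hf, v, hv0, hv⟩ := Fano.exists_isWeightVector_of_finrank_eq_eight hσ hV
  obtain ⟨z, hz0, hz⟩ := RegularMatroid.exists_homologyRep_isWeightVector hs hf
  exact WeightVector.nonempty_equiv Fano.card_singerNormalizer_ne_zero (Fano.satisfiesMackey hf)
    hv hv0 hσ RegularMatroid.isIrreducible_homologyRep hz hz0
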